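/- Let $N\ge 1$, $1<p<\infty$, $q,Q\in\mathbb{R}$, $a>-(N+1)$, $b>-1$. Let $\mathbb{B}$ be the open unit ball of $\mathbb{C}^N$, with $\langle z,w\rangle=\sum_i z_i\overline{w_i}$, let $\mu$ be Lebesgue measure on $\mathbb{B}$ normalized by $\mu(\mathbb{B})=1$, and for $r\in\mathbb{R}$ put $d\mu_r(z)=(1-|z|^2)^r\,d\mu(z)$. Let $$T_{a,b}f(z)=\int_{\mathbb{B}}\frac{f(w)\,(1-|w|^2)^{b-q}}{(1-\langle z,w\rangle)^{N+1+a}}\,d\mu_q(w)=\int_{\mathbb{B}}\frac{f(w)}{(1-\langle z,w\rangle)^{N+1+a}}\,d\mu_b(w).$$ Let $d$ be the pseudo-distance $d(z,w)=\big||z|-|w|\big|+\Big|1-\frac{\langle z,w\rangle}{|z||w|}\Big|$ for $z,w\neq 0$, and $d(z,w)=|z|+|w|$ if $z=0$ or $w=0$. For $\zeta\in\mathbb{B}$ and $R>0$ let $B=B(\zeta,R)=\{w\in\overline{\mathbb{B}}: d(\zeta,w)<R\}$ be the pseudo-ball of radius $R_B=R$; integrals and measures over $B$ are taken over $B\cap\mathbb{B}$.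 Write $p'=p/(p-1)$. Let $\omega$ be a weight, that is, a non-negative locally integrable function on $\mathbb{B}$ (with $0^{-1/(p-1)}=\infty$). Suppose that $T_{a,b}$ is well defined and continuous from $L^p(\omega\,d\mu_q)$ to $L^p(\omega\,d\mu_Q)$; that is, for every $f\in L^p(\omega\,d\mu_q)$ the integral defining $T_{a,b}f(z)$ converges absolutely for almost every $z\in\mathbb{B}$, and there is a constant $C<\infty$ such that $\|T_{a,b}f\|_{L^p(\omega d\mu_Q)}\le C\|f\|_{L^p(\omega d\mu_q)}$ for all such $f$. Then $\omega\in(B_p^{a,b,q,Q})$; that is, with $c=b$ if $Q\le q$ and $c=b+\frac{Q-q}{p}$ if $Q>q$, $$\sup_{B:\,B\cap\partial\mathbb{B}\neq\varnothing}\left(\frac{\mu_c(B)}{R_B^{2(N+1+a)}}\int_B\omega\,d\mu_Q\right)\left(\frac{\mu_c(B)}{R_B^{2(N+1+a)}}\int_B\omega^{-\frac{1}{p-1}}\,d\mu_{q+p'(b-q)}\right)^{p-1}<\infty,$$ and, if moreover $a>-1$, also $$\sup_{B:\,B\cap\partial\mathbb{B}\neq\varnothing}\left(\frac{\mu_c(B)}{\mu_a(B)^2}\int_B\omega\,d\mu_Q\right)\left(\frac{\mu_c(B)}{\mu_a(B)^2}\int_B\omega^{-\frac{1}{p-1}}\,d\mu_{q+p'(b-q)}\right)^{p-1}<\infty,$$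 the suprema being over all pseudo-balls $B=B(\zeta,R)$, $\zeta\in\mathbb{B}$, $R>0$, that meet $\partial\mathbb{B}$. -/

import Mathlib

open MeasureTheory Metric
open scoped ENNReal

noncomputable section

namespace BergmanBesov

/-- `ℂ^N` with its Hermitian norm. -/
abbrev CSpace (N : ℕ) : Type := EuclideanSpace ℂ (Fin N)

/-- The open unit ball `𝔹` of `ℂ^N`. -/
abbrev unitBall (N : ℕ) : Set (CSpace N) := ball 0 1

/-- The Hermitian product `⟨z, w⟩ = ∑ i, z i * conj (w i)`
(Mathlib's `inner` is conjugate-linear in its first argument). -/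
def herm {N : ℕ} (z w : CSpace N) : ℂ := inner ℂ w z

/-- Lebesgue measure on `ℂ^N = ∏ ℂ`, transported to the Hermitian space. -/
def lebesgue (N : ℕ) : Measure (CSpace N) :=
  Measure.map (WithLp.toLp 2) (volume : Measure (Fin N → ℂ))

/-- Lebesgue measure on the unit ball, normalized by `μ(𝔹) = 1`. -/
def mu (N : ℕ) : Measure (CSpace N) :=
  (lebesgue N (unitBall N))⁻¹ • (lebesgue N).restrict (unitBall N)

/-- `dμ_q(z) = (1 - |z|²)^q dμ(z)`, for any real `q`. -/
def muW (N : ℕ) (q : ℝ) : Measure (CSpace N) :=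
  (mu N).withDensity fun z => ENNReal.ofReal ((1 - ‖z‖ ^ 2) ^ q)

/-- The measure `ω dμ_q`. -/
def weightedMu {N : ℕ} (ω : CSpace N → ℝ) (q : ℝ) : Measure (CSpace N) :=
  (muW N q).withDensity fun z => ENNReal.ofReal (ω z)

/-- A weight: a non-negative locally integrable function on `𝔹`. -/
structure IsWeight {N : ℕ} (ω : CSpace N → ℝ) : Prop where
  nonneg : ∀ z ∈ unitBall N, 0 ≤ ω z
  locallyIntegrable : LocallyIntegrableOn ω (unitBall N) (lebesgue N)

/-- The Bergman–Besov kernel `K_a(z, w) = (1 - ⟨z, w⟩)^{-(N+1+a)}` for `a > -(N+1)`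
(principal branch; `Re (1 - ⟨z, w⟩) > 0` on `𝔹 × 𝔹`). -/
def kernel {N : ℕ} (a : ℝ) (z w : CSpace N) : ℂ :=
  1 / (1 - herm z w) ^ (((N : ℝ) + 1 + a : ℝ) : ℂ)

/-- The integrand (with respect to `dμ_q(w)`) of `T_{a,b} f(z)`. -/
def integrandT {N : ℕ} (a b q : ℝ) (f : CSpace N → ℂ) (z w : CSpace N) : ℂ :=
  kernel a z w * f w * (((1 - ‖w‖ ^ 2) ^ (b - q) : ℝ) : ℂ)

/-- `T_{a,b} f(z) = ∫_𝔹 K_a(z, w) f(w) (1 - |w|²)^{b-q} dμ_q(w)`. -/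
def opT {N : ℕ} (a b q : ℝ) (f : CSpace N → ℂ) (z : CSpace N) : ℂ :=
  ∫ w, integrandT a b q f z w ∂(muW N q)

/-- `T_{a,b}` is well defined and continuous from `L^p(ω dμ_q)` to `L^p(ω dμ_Q)`: for every
`f ∈ L^p(ω dμ_q)` the integral defining `T_{a,b} f(z)` converges absolutely for almost every
`z ∈ 𝔹`, and `‖T_{a,b} f‖ ≤ C ‖f‖` with a finite constant `C` independent of `f`. -/
def IsBoundedT {N : ℕ} (a b p q Q : ℝ) (ω : CSpace N → ℝ) : Prop :=
  (∀ f : CSpace N → ℂ, MemLp f (ENNReal.ofReal p) (weightedMu ω q) →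
    ∀ᵐ z ∂(mu N), Integrable (integrandT a b q f z) (muW N q)) ∧
  ∃ C : NNReal, ∀ f : CSpace N → ℂ, MemLp f (ENNReal.ofReal p) (weightedMu ω q) →
    eLpNorm (opT a b q f) (ENNReal.ofReal p) (weightedMu ω Q)
      ≤ C * eLpNorm f (ENNReal.ofReal p) (weightedMu ω q)

open Classical in
/-- The pseudo-distance `d(z, w) = ||z| - |w|| + |1 - ⟨z, w⟩ / (|z||w|)|`, with the usual
convention `d(z, w) = |z| + |w|` if `z` or `w` is the origin, where the formula makes no sense. -/
def pseudoDist {N : ℕ} (z w : CSpace N) : ℝ :=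
  if z = 0 ∨ w = 0 then ‖z‖ + ‖w‖
  else |‖z‖ - ‖w‖| + ‖1 - herm z w / ((‖z‖ * ‖w‖ : ℝ) : ℂ)‖

/-- The pseudo-ball `B(ζ, R)`, as a subset of the closed unit ball. The measures `muW N q` only
see its part in `𝔹`. -/
def pseudoBall {N : ℕ} (ζ : CSpace N) (R : ℝ) : Set (CSpace N) :=
  {w | w ∈ closedBall (0 : CSpace N) 1 ∧ pseudoDist ζ w < R}

/-- The pseudo-ball `B(ζ, R)` touches the boundary: `B(ζ, R) ∩ ∂𝔹 ≠ ∅`. -/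
def TouchesBoundary {N : ℕ} (ζ : CSpace N) (R : ℝ) : Prop :=
  (pseudoBall ζ R ∩ sphere (0 : CSpace N) 1).Nonempty

/-- The Békollé–Bonami type product on the pseudo-ball `B = B(ζ, R)` with normalizing factor `κ`:
`(κ ∫_B ω dμ_Q) (κ ∫_B ω^{-1/(p-1)} dμ_{q+p'(b-q)})^{p-1}`, where `p' = p/(p-1)`.
In `ℝ≥0∞` one has `0^{-1/(p-1)} = ∞`. -/
def bbProduct {N : ℕ} (b p q Q : ℝ) (ω : CSpace N → ℝ) (ζ : CSpace N) (R : ℝ) (κ : ℝ≥0∞) : ℝ≥0∞ :=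
  (κ * ∫⁻ z in pseudoBall ζ R, ENNReal.ofReal (ω z) ∂(muW N Q)) *
  (κ * ∫⁻ z in pseudoBall ζ R,
    (ENNReal.ofReal (ω z)) ^ (-1 / (p - 1)) ∂(muW N (q + p / (p - 1) * (b - q)))) ^ (p - 1)

/-- The supremum of the products over pseudo-balls touching the boundary, with factor
`μ_c(B) / μ_a(B)²`. -/
def bbSupMeasure {N : ℕ} (a b c p q Q : ℝ) (ω : CSpace N → ℝ) : ℝ≥0∞ :=
  ⨆ (ζ : CSpace N) (R : ℝ) (_ : ζ ∈ unitBall N) (_ : TouchesBoundary ζ R),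
    bbProduct b p q Q ω ζ R
      (muW N c (pseudoBall ζ R) / (muW N a (pseudoBall ζ R)) ^ 2)

/-- The supremum of the products over pseudo-balls touching the boundary, with factor
`μ_c(B) / R_B^{2(N+1+a)}`. -/
def bbSupRadius {N : ℕ} (a b c p q Q : ℝ) (ω : CSpace N → ℝ) : ℝ≥0∞ :=
  ⨆ (ζ : CSpace N) (R : ℝ) (_ : ζ ∈ unitBall N) (_ : TouchesBoundary ζ R),
    bbProduct b p q Q ω ζ R
      (muW N c (pseudoBall ζ R) / ENNReal.ofReal (R ^ (2 * ((N : ℝ) + 1 + a))))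

/-- `ω ∈ (B_p^{a,b,q,Q})`, for `a > -(N+1)` and `b > -1`. The numerator of the normalizing factor
is `μ_b(B)` if `Q ≤ q` and `μ_{b+(Q-q)/p}(B)` if `Q > q`; its denominator is `R_B^{2(N+1+a)}`.
If `a > -1` the condition with denominator `μ_a(B)²` is required as well. -/
def MemBp {N : ℕ} (a b p q Q : ℝ) (ω : CSpace N → ℝ) : Prop :=
  (Q ≤ q → (-1 < a → bbSupMeasure a b b p q Q ω < ∞) ∧ bbSupRadius a b b p q Q ω < ∞) ∧
  (q < Q → (-1 < a → bbSupMeasure a b (b + (Q - q) / p) p q Q ω < ∞) ∧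
    bbSupRadius a b (b + (Q - q) / p) p q Q ω < ∞)

end BergmanBesov

end

noncomputable section

namespace BergmanBesov

open Filter Topology

/-! ### The weighted measures: rotation invariance, null sets, total mass. -/

section Measures

variable {N : ℕ}

/-! The kernel is tested where it is almost constant, argument included. Put s = N + 1 + a, let σ be
the measure ω^{-1/(p-1)} dμ_{q+p'(b-q)}, and write ω_Q(E) for the integral of ω over E against μ_Q.

Small radii. If B = B(ζ, R) meets the sphere, then |1 - ⟨z, w⟩| ≤ 8R on B × B
(`norm_one_sub_herm_le_of_pseudoBall`). The kernel has no controlled argument there, so one copy of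
B is rotated by a unimodular l with |1 - l| a large multiple of R. On lB × B the quantity 1 - ⟨z, w⟩
then stays within a small relative error of 1 - l, and a constant phase gives the kernel real part
at least m ∼ R^{-s} (`exists_half_le_re_one_div_cpow`). Two tests follow, in opposite directions.
The extremal function of the duality on B gives ω_Q(lB) m^p σ(B)^{p-1} ≤ C^p. A power of 1 - |w|² on
lB gives ω_Q(B) (m μ_c(B))^p ≤ C^p ω_Q(lB), because μ_c is rotation invariant. Inserting the first
into the second bounds the product (`exists_weightedMu_mul_dualMu_pseudoBall_le`).

Large radii. If one variable is near the origin, the kernel is close to 1 whatever the other is.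
Testing there shows that ω > 0 almost everywhere and that ω_Q and σ have finite total mass
(`ae_weight_pos`, `weightedMu_univ_lt_top`, `dualMu_univ_lt_top`). With the finiteness of μ_c (c >
-1) this bounds the product for R bounded below.

Both regimes are recorded with denominator min(R, 1)^{2s}. The two normalizations are compared with
it: s > 0 handles R^{2s}, and μ_a(B) ≳ min(R, 1)^s (`exists_le_muW_pseudoBall`) handles μ_a(B)². -/

instance isAddHaarMeasure_lebesgue (N : ℕ) : (lebesgue N).IsAddHaarMeasure :=
  ContinuousLinearEquiv.isAddHaarMeasure_map
    (PiLp.continuousLinearEquiv 2 ℝ (fun _ : Fin N => ℂ)).symm volume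

lemma measurePreserving_toLp (N : ℕ) :
    MeasurePreserving (WithLp.toLp 2) (volume : Measure (Fin N → ℂ)) (lebesgue N) :=
  ⟨(PiLp.continuousLinearEquiv 2 ℝ (fun _ : Fin N => ℂ)).symm.continuous.measurable, rfl⟩

lemma lebesgue_unitBall_pos (N : ℕ) : 0 < lebesgue N (unitBall N) :=
  measure_ball_pos _ _ one_pos

lemma lebesgue_unitBall_lt_top (N : ℕ) : lebesgue N (unitBall N) < ∞ :=
  measure_ball_lt_top

lemma measurePreserving_linearIsometryEquiv (U : CSpace N ≃ₗᵢ[ℂ] CSpace N) :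
    MeasurePreserving U (lebesgue N) (lebesgue N) := by
  refine ⟨U.continuous.measurable, ?_⟩
  have : (Measure.map U (lebesgue N)).IsAddHaarMeasure :=
    ContinuousLinearEquiv.isAddHaarMeasure_map U.toContinuousLinearEquiv (lebesgue N)
  have h := Measure.isAddLeftInvariant_eq_smul (Measure.map U (lebesgue N)) (lebesgue N)
  set c := (Measure.map U (lebesgue N)).addHaarScalarFactor (lebesgue N) with hc
  have hball : (Measure.map U (lebesgue N)) (unitBall N) = lebesgue N (unitBall N) := by
    rw [Measure.map_apply U.continuous.measurable measurableSet_ball]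
    congr 1
    ext z
    simp
  have h2 : (c : ℝ≥0∞) * lebesgue N (unitBall N) = lebesgue N (unitBall N) := by
    conv_rhs => rw [← hball, h]
    rfl
  have h3 : (c : ℝ≥0∞) = 1 := by
    have := (ENNReal.mul_left_inj (c := lebesgue N (unitBall N)) (a := (c : ℝ≥0∞)) (b := 1)
      (lebesgue_unitBall_pos N).ne' (lebesgue_unitBall_lt_top N).ne).1 (by rw [h2, one_mul])
    exact this
  have h4 : c = 1 := by exact_mod_cast h3
  rw [h, h4, one_smul]

lemma mu_measurePreserving (U : CSpace N ≃ₗᵢ[ℂ] CSpace N) :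
    MeasurePreserving U (mu N) (mu N) := by
  have h := (measurePreserving_linearIsometryEquiv U).restrict_preimage
    (s := unitBall N) measurableSet_ball
  have hpre : U ⁻¹' unitBall N = unitBall N := by ext z; simp
  rw [hpre] at h
  exact h.smul_measure _

instance isFiniteMeasure_mu (N : ℕ) : IsFiniteMeasure (mu N) := by
  refine ⟨?_⟩
  simp only [mu, Measure.smul_apply, smul_eq_mul, Measure.restrict_apply_univ]
  exact ENNReal.mul_lt_top (ENNReal.inv_lt_top.2 (lebesgue_unitBall_pos N))
    (lebesgue_unitBall_lt_top N)

lemma mu_apply {s : Set (CSpace N)} (hs : MeasurableSet s) :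
    mu N s = (lebesgue N (unitBall N))⁻¹ * lebesgue N (s ∩ unitBall N) := by
  simp only [mu, Measure.smul_apply, smul_eq_mul, Measure.restrict_apply hs]

lemma mu_absolutelyContinuous : mu N ≪ (lebesgue N).restrict (unitBall N) :=
  Measure.smul_absolutelyContinuous

lemma ae_mem_unitBall : ∀ᵐ z ∂(mu N), z ∈ unitBall N :=
  mu_absolutelyContinuous.ae_le (ae_restrict_mem measurableSet_ball)

lemma one_sub_norm_sq_pos {z : CSpace N} (hz : z ∈ unitBall N) : 0 < 1 - ‖z‖ ^ 2 := by
  have h : ‖z‖ < 1 := by simpa using hz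
  nlinarith [norm_nonneg z]

lemma measurable_density (r : ℝ) :
    Measurable fun z : CSpace N => ENNReal.ofReal ((1 - ‖z‖ ^ 2) ^ r) := by
  fun_prop

lemma muW_absolutelyContinuous (r : ℝ) : muW N r ≪ mu N :=
  withDensity_absolutelyContinuous _ _

lemma mu_absolutelyContinuous_muW (r : ℝ) : mu N ≪ muW N r := by
  refine withDensity_absolutelyContinuous' (measurable_density r).aemeasurable ?_
  filter_upwards [ae_mem_unitBall] with z hz
  exact (ENNReal.ofReal_pos.2 (Real.rpow_pos_of_pos (one_sub_norm_sq_pos hz) _)).ne'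

lemma lintegral_muW (r : ℝ) (f : CSpace N → ℝ≥0∞) :
    ∫⁻ z, f z ∂(muW N r) = ∫⁻ z, ENNReal.ofReal ((1 - ‖z‖ ^ 2) ^ r) * f z ∂(mu N) :=
  lintegral_withDensity_eq_lintegral_mul_non_measurable _ (measurable_density r)
    (ae_of_all _ fun _ => ENNReal.ofReal_lt_top) f

lemma muW_apply (r : ℝ) {s : Set (CSpace N)} (hs : MeasurableSet s) :
    muW N r s = ∫⁻ z in s, ENNReal.ofReal ((1 - ‖z‖ ^ 2) ^ r) ∂(mu N) :=
  withDensity_apply _ hs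

instance sigmaFinite_muW (N : ℕ) (r : ℝ) : SigmaFinite (muW N r) :=
  SigmaFinite.withDensity_of_ne_top (ae_of_all _ fun _ => ENNReal.ofReal_ne_top)

lemma muW_preimage (U : CSpace N ≃ₗᵢ[ℂ] CSpace N) (r : ℝ) {s : Set (CSpace N)}
    (hs : MeasurableSet s) : muW N r (U ⁻¹' s) = muW N r s := by
  rw [muW_apply r hs, muW_apply r (U.continuous.measurable hs),
    ← (mu_measurePreserving U).setLIntegral_comp_preimage hs (measurable_density r)]
  simp only [LinearIsometryEquiv.norm_map]

lemma mu_ball_pos {ε : ℝ} (hε : 0 < ε) (hε1 : ε ≤ 1) : 0 < mu N (ball 0 ε) := by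
  rw [mu_apply measurableSet_ball, Set.inter_eq_left.2 (ball_subset_ball hε1)]
  exact ENNReal.mul_pos (ENNReal.inv_ne_zero.2 (lebesgue_unitBall_lt_top N).ne)
    (measure_ball_pos _ _ hε).ne'

lemma integrableOn_one_sub_sq_rpow {c : ℝ} (hc : -1 < c) :
    IntegrableOn (fun y : ℝ => (1 - y ^ 2) ^ c) (Set.Ioo 0 1) := by
  have h1 : IntervalIntegrable (fun y : ℝ => (1 - y) ^ c) volume 0 1 := by
    have := (intervalIntegral.intervalIntegrable_rpow' (a := 1) (b := 0) hc).comp_sub_left 1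
    simpa using this
  have h2 : IntegrableOn (fun y : ℝ => (1 - y) ^ c) (Set.Ioo 0 1) :=
    ((intervalIntegrable_iff_integrableOn_Ioo_of_le zero_le_one).1 h1)
  refine (h2.mul_const (max 1 (2 ^ c))).mono'
    (Measurable.aestronglyMeasurable (by measurability)) ?_
  refine (ae_restrict_iff' measurableSet_Ioo).2 (ae_of_all _ fun y hy => ?_)
  have hy1 : 0 < 1 - y := by linarith [hy.2]
  have hy2 : 0 < 1 + y := by linarith [hy.1]
  have e : (1 - y ^ 2) = (1 - y) * (1 + y) := by ring
  rw [e, Real.mul_rpow hy1.le hy2.le, Real.norm_of_nonneg (by positivity)]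
  refine mul_le_mul_of_nonneg_left ?_ (by positivity)
  rcases le_total 0 c with h | h
  · exact (Real.rpow_le_rpow hy2.le (by linarith [hy.2]) h).trans (le_max_right _ _)
  · exact (Real.rpow_le_one_of_one_le_of_nonpos (by linarith [hy.1]) h).trans (le_max_left _ _)

/-- Polar coordinates reduce this to the integral of (1 - y²)^c over (0, 1), the Jacobian power of y
being at most 1. -/
lemma muW_univ_lt_top (hN : 1 ≤ N) {c : ℝ} (hc : -1 < c) : muW N c Set.univ < ∞ := by
  have : Nonempty (Fin N) := ⟨⟨0, hN⟩⟩
  have : Nontrivial (CSpace N) := inferInstance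
  have key : Integrable (fun x : CSpace N =>
      (Set.Ioo (-1 : ℝ) 1).indicator (fun y => (1 - y ^ 2) ^ c) ‖x‖) (lebesgue N) := by
    rw [integrable_fun_norm_addHaar (lebesgue N)
      (f := (Set.Ioo (-1 : ℝ) 1).indicator (fun y => (1 - y ^ 2) ^ c))]
    have h := (integrable_indicator_iff measurableSet_Ioo).2 (integrableOn_one_sub_sq_rpow hc)
    refine h.integrableOn.mono' (Measurable.aestronglyMeasurable ?_) ?_
    · have m1 : Measurable fun y : ℝ => (1 - y ^ 2) ^ c := by measurability
      have m2 : Measurable fun y : ℝ => y ^ (Module.finrank ℝ (CSpace N) - 1) := by fun_prop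
      exact m2.smul (m1.indicator measurableSet_Ioo)
    refine (ae_restrict_iff' measurableSet_Ioi).2 (ae_of_all _ fun y hy => ?_)
    have hy : 0 < y := hy
    by_cases h1 : y < 1
    · have hpos : 0 < 1 - y ^ 2 := by nlinarith
      rw [Set.indicator_of_mem (show y ∈ Set.Ioo (-1 : ℝ) 1 from ⟨by linarith, h1⟩),
        Set.indicator_of_mem (show y ∈ Set.Ioo (0 : ℝ) 1 from ⟨hy, h1⟩), norm_smul,
        Real.norm_of_nonneg (by positivity), Real.norm_of_nonneg (by positivity)]
      exact mul_le_of_le_one_left (by positivity) (pow_le_one₀ hy.le h1.le)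
    · rw [Set.indicator_of_notMem (fun h => h1 h.2), Set.indicator_of_notMem (fun h => h1 h.2)]
      simp
  rw [← setLIntegral_one, Measure.restrict_univ, lintegral_muW]
  simp only [mul_one, mu, lintegral_smul_measure, smul_eq_mul]
  refine ENNReal.mul_lt_top (ENNReal.inv_lt_top.2 (lebesgue_unitBall_pos N)) ?_
  refine lt_of_le_of_lt ?_ key.lintegral_lt_top
  rw [← lintegral_indicator measurableSet_ball]
  refine lintegral_mono fun x => ?_
  by_cases hx : x ∈ unitBall N
  · have hx' : ‖x‖ < 1 := by simpa using hx
    rw [Set.indicator_of_mem hx, Set.indicator_of_mem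
      (show ‖x‖ ∈ Set.Ioo (-1 : ℝ) 1 from ⟨by linarith [norm_nonneg x], hx'⟩)]
  · simp [Set.indicator_of_notMem hx]

/-- `|x|^{-2N}` is not integrable at the origin. -/
lemma not_integrableOn_norm_rpow (hN : 1 ≤ N) {ε : ℝ} (hε : 0 < ε) :
    ¬ IntegrableOn (fun x : CSpace N => (‖x‖ ^ (2 * N))⁻¹) (ball 0 ε) (lebesgue N) := by
  have : Nonempty (Fin N) := ⟨⟨0, hN⟩⟩
  have : Nontrivial (CSpace N) := inferInstance
  intro h
  have h1 : Integrable (fun x : CSpace N =>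
      (Set.Iio ε).indicator (fun y => (y ^ (2 * N))⁻¹) ‖x‖) (lebesgue N) := by
    rw [← integrable_indicator_iff measurableSet_ball] at h
    refine h.congr (ae_of_all _ fun x => ?_)
    simp only
    by_cases hx : ‖x‖ < ε
    · rw [Set.indicator_of_mem (show ‖x‖ ∈ Set.Iio ε from hx),
        Set.indicator_of_mem (show x ∈ ball 0 ε by simpa using hx)]
    · rw [Set.indicator_of_notMem (show ‖x‖ ∉ Set.Iio ε from hx),
        Set.indicator_of_notMem (show x ∉ ball 0 ε by simpa using hx)]
  rw [integrable_fun_norm_addHaar (lebesgue N)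
    (f := (Set.Iio ε).indicator (fun y => (y ^ (2 * N))⁻¹))] at h1
  have hdim : Module.finrank ℝ (CSpace N) = 2 * N := by
    rw [finrank_real_of_complex]; simp
  -- In real dimension 2N the polar density y^{2N-1} turns |x|^{-2N} into 1/y.
  have h2 : IntegrableOn (fun y : ℝ => y⁻¹) (Set.Ioo 0 ε) := by
    refine (h1.mono_set Set.Ioo_subset_Ioi_self).congr_fun (fun y hy => ?_) measurableSet_Ioo
    have hy0 : y ≠ 0 := hy.1.ne'
    simp only
    rw [Set.indicator_of_mem (show y ∈ Set.Iio ε from hy.2), hdim, smul_eq_mul]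
    obtain ⟨k, hk⟩ : ∃ k, 2 * N = k + 1 := ⟨2 * N - 1, by omega⟩
    rw [hk, Nat.add_sub_cancel, pow_succ]
    field_simp
  have h3 : IntervalIntegrable (fun y : ℝ => y⁻¹) volume 0 ε :=
    (intervalIntegrable_iff_integrableOn_Ioo_of_le hε.le).2 h2
  rw [intervalIntegrable_inv_iff] at h3
  rcases h3 with h3 | h3
  · exact hε.ne h3
  · exact h3 (by simp)

end Measures

/-! ### Pseudo-balls near the boundary and the size of 1 - ⟨z, w⟩. -/

section Geometry

variable {N : ℕ}

lemma norm_herm_le (z w : CSpace N) : ‖herm z w‖ ≤ ‖z‖ * ‖w‖ := by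
  rw [mul_comm]; exact norm_inner_le_norm w z

lemma herm_smul_left (l : ℂ) (z w : CSpace N) : herm (l • z) w = l * herm z w := by
  exact inner_smul_right _ _ _

lemma herm_smul_right (l : ℂ) (z w : CSpace N) :
    herm z (l • w) = (starRingEnd ℂ) l * herm z w := by
  exact inner_smul_left _ _ _

lemma measurable_pseudoDist (ζ : CSpace N) : Measurable (pseudoDist ζ) := by
  unfold pseudoDist
  by_cases h : ζ = 0
  · simp only [h, true_or, if_true]; fun_prop
  · simp only [h, false_or]
    refine Measurable.ite (by simp) (by fun_prop) ?_
    have : Measurable fun w : CSpace N => herm ζ w := by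
      unfold herm
      exact (continuous_id.inner continuous_const).measurable
    fun_prop

lemma measurableSet_pseudoBall (ζ : CSpace N) (R : ℝ) : MeasurableSet (pseudoBall ζ R) :=
  measurableSet_closedBall.inter (measurableSet_lt (measurable_pseudoDist ζ) measurable_const)

/-- The radial term of the pseudo-distance alone forces this; it is all that the proof takes from
contact with the sphere. -/
lemma TouchesBoundary.one_sub_norm_lt {ζ : CSpace N} {R : ℝ}
    (h : TouchesBoundary ζ R) : 1 - ‖ζ‖ < R := by
  obtain ⟨η, ⟨-, hd⟩, hη⟩ := h
  have hη : ‖η‖ = 1 := by simpa using hη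
  unfold pseudoDist at hd
  split_ifs at hd with h0
  · linarith [norm_nonneg ζ]
  · have h1 := neg_abs_le (‖ζ‖ - ‖η‖)
    have h2 := norm_nonneg (1 - herm ζ η / ((‖ζ‖ * ‖η‖ : ℝ) : ℂ))
    linarith

/-- The direction `z / |z|`. -/
def direction (z : CSpace N) : CSpace N := ((‖z‖⁻¹ : ℝ) : ℂ) • z

lemma norm_direction {z : CSpace N} (hz : z ≠ 0) : ‖direction z‖ = 1 := by
  simp [direction, norm_smul, hz]

lemma herm_div_norm (z w : CSpace N) :
    herm z w / ((‖z‖ * ‖w‖ : ℝ) : ℂ) = herm (direction z) (direction w) := by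
  simp only [direction, herm_smul_left, herm_smul_right, Complex.conj_ofReal]
  push_cast
  rw [div_eq_mul_inv, mul_inv]; ring

lemma pseudoDist_eq {z w : CSpace N} (hz : z ≠ 0) (hw : w ≠ 0) :
    pseudoDist z w = |‖z‖ - ‖w‖| + ‖1 - herm (direction z) (direction w)‖ := by
  simp [pseudoDist, hz, hw, ← herm_div_norm]

lemma herm_conj_symm (z w : CSpace N) : (starRingEnd ℂ) (herm z w) = herm w z :=
  inner_conj_symm z w

lemma norm_one_sub_herm_symm (z w : CSpace N) : ‖1 - herm z w‖ = ‖1 - herm w z‖ := by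
  rw [← herm_conj_symm w z, ← Complex.norm_conj (1 - herm w z)]; simp

lemma norm_sub_sq_le_two_mul {x y : CSpace N} (hx : ‖x‖ = 1) (hy : ‖y‖ = 1) :
    ‖x - y‖ ^ 2 ≤ 2 * ‖1 - herm x y‖ := by
  have h := @norm_sub_sq ℂ _ _ _ _ x y
  have h2 := Complex.re_le_norm (1 - herm x y)
  have h3 : (herm x y).re = RCLike.re (inner ℂ x y) := by
    rw [← herm_conj_symm y x, Complex.conj_re]; rfl
  simp only [Complex.sub_re, Complex.one_re] at h2
  rw [h, hx, hy, ← h3]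
  linarith

/-- A quasi-triangle inequality for `|1 - ⟨x, y⟩|` on the unit sphere. -/
lemma norm_one_sub_herm_le_of_sphere {x y u : CSpace N} (hx : ‖x‖ = 1) (hy : ‖y‖ = 1)
    (hu : ‖u‖ = 1) {r : ℝ} (hxu : ‖1 - herm u x‖ ≤ r) (hyu : ‖1 - herm u y‖ ≤ r) :
    ‖1 - herm x y‖ ≤ 4 * r := by
  have huu : herm u u = 1 := by
    simp [herm, inner_self_eq_norm_sq_to_K, hu]
  -- The first two terms cost r each. By Cauchy–Schwarz and |x - u|², |y - u|² ≤ 2r, the last one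
  -- costs 2r.
  have e : 1 - herm x y = (1 - herm x u) + (1 - herm u y) - herm (x - u) (y - u) := by
    have : herm (x - u) (y - u) = herm x y - herm x u - herm u y + herm u u := by
      simp only [herm, inner_sub_left, inner_sub_right]; ring
    rw [this, huu]; ring
  have h1 : ‖x - u‖ ^ 2 ≤ 2 * r := (norm_sub_sq_le_two_mul hx hu).trans
    (by rw [norm_one_sub_herm_symm]; linarith)
  have h2 : ‖y - u‖ ^ 2 ≤ 2 * r := (norm_sub_sq_le_two_mul hy hu).trans
    (by rw [norm_one_sub_herm_symm]; linarith)
  have h3 := norm_herm_le (x - u) (y - u)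
  have h4 : ‖1 - herm x y‖ ≤ ‖1 - herm x u‖ + ‖1 - herm u y‖ + ‖herm (x - u) (y - u)‖ := by
    rw [e]; exact (norm_sub_le _ _).trans (by gcongr; exact norm_add_le _ _)
  rw [norm_one_sub_herm_symm] at hxu
  nlinarith [sq_nonneg (‖x - u‖ - ‖y - u‖)]

/-- Points of the ball lie within 2R of the sphere, so the radial defect 1 - |z||w| is at most 4R;
the angular part is at most 4R by the quasi-triangle inequality. The bound R ≤ 1/2 keeps the origin
out of the ball. -/
lemma norm_one_sub_herm_le_of_pseudoBall {ζ z w : CSpace N} {R : ℝ} (hR : R ≤ 1 / 2)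
    (hζ : ζ ∈ unitBall N) (hζR : 1 - ‖ζ‖ < R) (hz : z ∈ pseudoBall ζ R)
    (hw : w ∈ pseudoBall ζ R) : ‖1 - herm z w‖ ≤ 8 * R := by
  have hζ0 : ζ ≠ 0 := by rintro rfl; simp at hζR; linarith
  have hζ1 : ‖ζ‖ < 1 := by simpa using hζ
  have aux : ∀ v ∈ pseudoBall ζ R, v ≠ 0 ∧ ‖v‖ ≤ 1 ∧ 1 - ‖v‖ ≤ 2 * R ∧
      ‖1 - herm (direction ζ) (direction v)‖ ≤ R := by
    rintro v ⟨hv1, hv⟩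
    have hv0 : v ≠ 0 := by
      rintro rfl
      simp [pseudoDist] at hv
      linarith
    rw [pseudoDist_eq hζ0 hv0] at hv
    have h1 := le_abs_self (‖ζ‖ - ‖v‖)
    have h2 := abs_nonneg (‖ζ‖ - ‖v‖)
    have h3 := norm_nonneg (1 - herm (direction ζ) (direction v))
    exact ⟨hv0, by simpa using hv1, by linarith, by linarith⟩
  obtain ⟨hz0, hz1, hz2, hz3⟩ := aux z hz
  obtain ⟨hw0, hw1, hw2, hw3⟩ := aux w hw
  have hdir := norm_one_sub_herm_le_of_sphere (norm_direction hz0) (norm_direction hw0)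
    (norm_direction hζ0) hz3 hw3
  set h := herm (direction z) (direction w) with hh
  have hzw : herm z w = ((‖z‖ * ‖w‖ : ℝ) : ℂ) * h := by
    rw [hh, ← herm_div_norm, mul_div_cancel₀]
    have := norm_ne_zero_iff.2 hz0
    have := norm_ne_zero_iff.2 hw0
    exact_mod_cast mul_ne_zero ‹_› ‹_›
  have e : 1 - herm z w = ((1 - ‖z‖ * ‖w‖ : ℝ) : ℂ) + ((‖z‖ * ‖w‖ : ℝ) : ℂ) * (1 - h) := by
    rw [hzw]; push_cast; ring
  have hprod : ‖z‖ * ‖w‖ ≤ 1 := mul_le_one₀ hz1 (norm_nonneg _) hw1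
  have hprod0 : 0 ≤ ‖z‖ * ‖w‖ := by positivity
  have hprod2 : 1 - ‖z‖ * ‖w‖ ≤ 4 * R := by nlinarith [norm_nonneg z, norm_nonneg w]
  rw [e]
  refine (norm_add_le _ _).trans ?_
  rw [norm_mul, Complex.norm_real, Complex.norm_real, Real.norm_of_nonneg (by linarith),
    Real.norm_of_nonneg hprod0]
  nlinarith [norm_nonneg (1 - h)]

end Geometry

/-! ### Near-constancy of x ↦ x^{-s} on the right half-plane. -/

section Kernel

lemma exists_norm_eq_one_norm_one_sub_eq {t : ℝ} (ht0 : 0 ≤ t) (ht : t ≤ 1) :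
    ∃ l : ℂ, ‖l‖ = 1 ∧ ‖1 - l‖ = t ∧ (1 - l).re = t ^ 2 / 2 := by
  have h0 : 0 ≤ 1 - (1 - t ^ 2 / 2) ^ 2 := by
    nlinarith [mul_nonneg (sq_nonneg t) (show 0 ≤ 1 - t ^ 2 / 4 by nlinarith)]
  -- For unimodular l, |1 - l|² = 2 - 2 Re l, which dictates the real part.
  refine ⟨⟨1 - t ^ 2 / 2, √(1 - (1 - t ^ 2 / 2) ^ 2)⟩, ?_, ?_, by simp⟩
  · rw [Complex.norm_def, Complex.normSq_mk, Real.mul_self_sqrt h0]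
    rw [← Real.sqrt_one]; congr 1; ring
  · have e : (1 : ℂ) - ⟨1 - t ^ 2 / 2, √(1 - (1 - t ^ 2 / 2) ^ 2)⟩ =
        ⟨t ^ 2 / 2, -√(1 - (1 - t ^ 2 / 2) ^ 2)⟩ := by
      apply Complex.ext <;> simp
    rw [e, Complex.norm_def, Complex.normSq_mk, neg_mul_neg, Real.mul_self_sqrt h0,
      show t ^ 2 / 2 * (t ^ 2 / 2) + (1 - (1 - t ^ 2 / 2) ^ 2) = t ^ 2 by ring,
      Real.sqrt_sq ht0]

/-- Near a point `k` of the right half-plane, `1 / x ^ s` stays close to `1 / k ^ s`, with a relative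
tolerance that does not depend on `k`. -/
lemma exists_half_le_re_one_div_cpow (s : ℝ) :
    ∃ ε : ℝ, 0 < ε ∧ ε < 1 ∧ ∀ k : ℂ, 0 < k.re → ∃ u : ℂ, ‖u‖ = 1 ∧
      ∀ x : ℂ, ‖x - k‖ ≤ ε * ‖k‖ → ‖k‖ ^ (-s) / 2 ≤ (u * (1 / x ^ (s : ℂ))).re := by
  -- By homogeneity only k = 1 matters, where continuity suffices; this is why ε is independent of
  -- k.
  have hc : ContinuousAt (fun y : ℂ => (1 / y ^ (s : ℂ)).re) 1 := by
    refine Complex.continuous_re.continuousAt.comp ?_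
    refine ContinuousAt.div continuousAt_const
      (continuousAt_id.cpow continuousAt_const (by simp)) (by simp)
  have hev : ∀ᶠ y in 𝓝 (1 : ℂ), 1 / 2 < (1 / y ^ (s : ℂ)).re :=
    hc.eventually (lt_mem_nhds (by simp; norm_num))
  obtain ⟨ε, hε, hball⟩ := Metric.eventually_nhds_iff.1 hev
  refine ⟨min (ε / 2) (1 / 2), by positivity, by
    exact (min_le_right _ _).trans_lt (by norm_num), fun k hk => ?_⟩
  have hk0 : k ≠ 0 := by rintro rfl; simp at hk
  have hkn : 0 < ‖k‖ := norm_pos_iff.2 hk0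
  -- This u is the phase of k^s, which cancels that of 1 / k^s.
  refine ⟨k ^ (s : ℂ) * ((‖k‖ ^ (-s) : ℝ) : ℂ), ?_, fun x hx => ?_⟩
  · rw [norm_mul, Complex.norm_cpow_real, Complex.norm_real, Real.norm_of_nonneg (by positivity),
      ← Real.rpow_add hkn]
    simp
  obtain ⟨y, rfl⟩ : ∃ y, x = k * y := ⟨x / k, by field_simp⟩
  have hy : ‖y - 1‖ ≤ min (ε / 2) (1 / 2) := by
    have e : k * y - k = k * (y - 1) := by ring
    rw [e, norm_mul, mul_comm] at hx
    exact le_of_mul_le_mul_right hx hkn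
  have hy1 : dist y 1 < ε := by
    rw [dist_eq_norm]; linarith [min_le_left (ε / 2) (1 / 2)]
  have hyre : 0 < y.re := by
    have h1 := Complex.abs_re_le_norm (y - 1)
    simp only [Complex.sub_re, Complex.one_re] at h1
    linarith [min_le_right (ε / 2) (1 / 2), neg_abs_le (y.re - 1)]
  have hy0 : y ≠ 0 := by rintro rfl; simp at hyre
  -- Both arguments lie in (-π/2, π/2), so their sum avoids the branch cut.
  have hmul : (k * y) ^ (s : ℂ) = k ^ (s : ℂ) * y ^ (s : ℂ) := by
    have a1 := abs_lt.1 (Complex.abs_arg_lt_pi_div_two_iff.2 (Or.inl hk))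
    have a2 := abs_lt.1 (Complex.abs_arg_lt_pi_div_two_iff.2 (Or.inl hyre))
    rw [Complex.cpow_def_of_ne_zero (mul_ne_zero hk0 hy0), Complex.cpow_def_of_ne_zero hk0,
      Complex.cpow_def_of_ne_zero hy0, Complex.log_mul hk0 hy0
      ⟨by linarith [a1.1, a2.1], by linarith [a1.2, a2.2]⟩, ← Complex.exp_add]
    congr 1; ring
  have hks : k ^ (s : ℂ) ≠ 0 := by simp [Complex.cpow_eq_zero_iff, hk0]
  have e : k ^ (s : ℂ) * ((‖k‖ ^ (-s) : ℝ) : ℂ) * (1 / (k * y) ^ (s : ℂ)) =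
      ((‖k‖ ^ (-s) : ℝ) : ℂ) * (1 / y ^ (s : ℂ)) := by
    rw [hmul]; field_simp
  rw [e, Complex.re_ofReal_mul, div_eq_mul_one_div]
  exact mul_le_mul_of_nonneg_left (hball hy1).le (by positivity)

end Kernel

/-! ### Test inequalities for sets E, F on which the rotated kernel is bounded below. -/

section TestFunctions

variable {N : ℕ} {a b p q Q : ℝ} {ω : CSpace N → ℝ}

lemma IsWeight.aemeasurable (hω : IsWeight ω) : AEMeasurable ω (mu N) :=
  (hω.locallyIntegrable.aestronglyMeasurable.aemeasurable).mono_ac mu_absolutelyContinuous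

lemma aemeasurable_muW {α : Type*} [MeasurableSpace α] {f : CSpace N → α}
    (hf : AEMeasurable f (mu N)) (r : ℝ) : AEMeasurable f (muW N r) :=
  hf.mono_ac (muW_absolutelyContinuous r)

lemma weightedMu_absolutelyContinuous (ω : CSpace N → ℝ) (r : ℝ) : weightedMu ω r ≪ mu N :=
  (withDensity_absolutelyContinuous _ _).trans (muW_absolutelyContinuous r)

lemma weightedMu_apply_eq_zero_iff (hω : AEMeasurable ω (mu N)) (r : ℝ) (s : Set (CSpace N)) :
    weightedMu ω r s = 0 ↔ mu N ({z | ENNReal.ofReal (ω z) ≠ 0} ∩ s) = 0 := by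
  rw [weightedMu, withDensity_apply_eq_zero' (aemeasurable_muW hω r).ennreal_ofReal]
  exact ⟨fun h => mu_absolutelyContinuous_muW r h, fun h => muW_absolutelyContinuous r h⟩

lemma lintegral_weightedMu (hω : AEMeasurable ω (mu N)) (r : ℝ) {f : CSpace N → ℝ≥0∞}
    (hf : AEMeasurable f (mu N)) :
    ∫⁻ z, f z ∂(weightedMu ω r) =
      ∫⁻ z, ENNReal.ofReal ((1 - ‖z‖ ^ 2) ^ r) * (ENNReal.ofReal (ω z) * f z) ∂(mu N) := by
  rw [weightedMu, lintegral_withDensity_eq_lintegral_mul₀ (aemeasurable_muW hω r).ennreal_ofReal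
    (aemeasurable_muW hf r), lintegral_muW]
  rfl

lemma weightedMu_apply (ω : CSpace N → ℝ) (r : ℝ) {s : Set (CSpace N)} (hs : MeasurableSet s) :
    weightedMu ω r s = ∫⁻ z, ENNReal.ofReal ((1 - ‖z‖ ^ 2) ^ r) *
      s.indicator (fun z => ENNReal.ofReal (ω z)) z ∂(mu N) := by
  rw [weightedMu, withDensity_apply _ hs, ← lintegral_indicator hs, lintegral_muW]

/-- The lower bound `|T f(z)| ≥ m ∫ f dμ_b` at a point `z` where the kernel, rotated by `u`, has
real part at least `m` on the support of `f ≥ 0`. -/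
lemma le_enorm_opT {f : CSpace N → ℝ} (hf0 : ∀ w, 0 ≤ f w)
    {E : Set (CSpace N)} (hfE : ∀ w ∉ E, f w = 0) {u : ℂ} (hu : ‖u‖ = 1) {m : ℝ} (hm : 0 ≤ m)
    {z : CSpace N} (hk : ∀ w ∈ E ∩ unitBall N, m ≤ (u * kernel a z w).re)
    (hint : Integrable (integrandT a b q (fun w => (f w : ℂ)) z) (muW N q)) :
    ENNReal.ofReal m * ∫⁻ w, ENNReal.ofReal (f w) ∂(muW N b) ≤
      ‖opT a b q (fun w => (f w : ℂ)) z‖ₑ := by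
  set h := integrandT a b q (fun w => (f w : ℂ)) z with hh
  have hint2 : Integrable (fun w => (u * h w).re) (muW N q) := (hint.const_mul u).re
  have hpt : ∀ᵐ w ∂(mu N), m * (f w * (1 - ‖w‖ ^ 2) ^ (b - q)) ≤ (u * h w).re := by
    filter_upwards [ae_mem_unitBall] with w hw
    have e : (u * h w) = (u * kernel a z w) * ((f w * (1 - ‖w‖ ^ 2) ^ (b - q) : ℝ) : ℂ) := by
      rw [hh, integrandT]; push_cast; ring
    rw [e, Complex.re_mul_ofReal]
    by_cases hwE : w ∈ E
    · exact mul_le_mul_of_nonneg_right (hk w ⟨hwE, hw⟩)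
        (mul_nonneg (hf0 w) (Real.rpow_nonneg (one_sub_norm_sq_pos hw).le _))
    · simp [hfE w hwE]
  have hnn : 0 ≤ᵐ[muW N q] fun w => (u * h w).re := by
    refine (muW_absolutelyContinuous q).ae_le ?_
    filter_upwards [hpt, ae_mem_unitBall] with w hw hwB
    exact (mul_nonneg hm (mul_nonneg (hf0 w)
      (Real.rpow_nonneg (one_sub_norm_sq_pos hwB).le _))).trans hw
  calc ENNReal.ofReal m * ∫⁻ w, ENNReal.ofReal (f w) ∂(muW N b)
      = ∫⁻ w, ENNReal.ofReal ((1 - ‖w‖ ^ 2) ^ q) *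
          ENNReal.ofReal (m * (f w * (1 - ‖w‖ ^ 2) ^ (b - q))) ∂(mu N) := by
        rw [← lintegral_const_mul' _ _ ENNReal.ofReal_ne_top, lintegral_muW]
        refine lintegral_congr_ae ?_
        filter_upwards [ae_mem_unitBall] with w hw
        have hx := one_sub_norm_sq_pos hw
        rw [← ENNReal.ofReal_mul hm, ← ENNReal.ofReal_mul (by positivity),
          ← ENNReal.ofReal_mul (by positivity)]
        congr 1
        have : (1 - ‖w‖ ^ 2) ^ b = (1 - ‖w‖ ^ 2) ^ q * (1 - ‖w‖ ^ 2) ^ (b - q) := by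
          rw [← Real.rpow_add hx]; congr 1; ring
        rw [this]; ring
    _ ≤ ∫⁻ w, ENNReal.ofReal ((1 - ‖w‖ ^ 2) ^ q) * ENNReal.ofReal (u * h w).re ∂(mu N) := by
        refine lintegral_mono_ae ?_
        filter_upwards [hpt] with w hw
        gcongr
    _ = ∫⁻ w, ENNReal.ofReal (u * h w).re ∂(muW N q) := (lintegral_muW _ _).symm
    _ = ENNReal.ofReal (∫ w, (u * h w).re ∂(muW N q)) :=
        (ofReal_integral_eq_lintegral_ofReal hint2 hnn).symm
    _ = ENNReal.ofReal (u * ∫ w, h w ∂(muW N q)).re := by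
        congr 1
        rw [← integral_const_mul]
        exact integral_re (hint.const_mul u)
    _ ≤ ENNReal.ofReal ‖∫ w, h w ∂(muW N q)‖ := by
        refine ENNReal.ofReal_le_ofReal ((Complex.re_le_norm _).trans ?_)
        rw [norm_mul, hu, one_mul]
    _ = ‖opT a b q (fun w => (f w : ℂ)) z‖ₑ := by rw [ofReal_norm]; rfl

lemma enorm_ofReal_of_nonneg {x : ℝ} (hx : 0 ≤ x) : ‖(x : ℂ)‖ₑ = ENNReal.ofReal x := by
  rw [← ofReal_norm, Complex.norm_real, Real.norm_of_nonneg hx]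

/-- Testing the boundedness of `T` on a non-negative function supported in `E`, with the image
restricted to `F`, when the rotated kernel has real part at least `m` on `F × E`. -/
lemma weightedMu_mul_rpow_le (hp : 1 < p)
    (hT : ∀ f : CSpace N → ℂ, MemLp f (ENNReal.ofReal p) (weightedMu ω q) →
      ∀ᵐ z ∂(mu N), Integrable (integrandT a b q f z) (muW N q))
    {C : NNReal} (hC : ∀ f : CSpace N → ℂ, MemLp f (ENNReal.ofReal p) (weightedMu ω q) →
      eLpNorm (opT a b q f) (ENNReal.ofReal p) (weightedMu ω Q)
        ≤ C * eLpNorm f (ENNReal.ofReal p) (weightedMu ω q))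
    {f : CSpace N → ℝ} (hf : AEMeasurable f (mu N)) (hf0 : ∀ w, 0 ≤ f w)
    {E F : Set (CSpace N)} (hF : MeasurableSet F) (hfE : ∀ w ∉ E, f w = 0)
    {u : ℂ} (hu : ‖u‖ = 1) {m : ℝ} (hm : 0 ≤ m)
    (hk : ∀ z ∈ F ∩ unitBall N, ∀ w ∈ E ∩ unitBall N, m ≤ (u * kernel a z w).re)
    (hfin : ∫⁻ w, ENNReal.ofReal (f w) ^ p ∂(weightedMu ω q) ≠ ∞) :
    weightedMu ω Q F * (ENNReal.ofReal m * ∫⁻ w, ENNReal.ofReal (f w) ∂(muW N b)) ^ p ≤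
      (C : ℝ≥0∞) ^ p * ∫⁻ w, ENNReal.ofReal (f w) ^ p ∂(weightedMu ω q) := by
  have hp0 : 0 < p := by linarith
  have hpE : ENNReal.ofReal p ≠ 0 := (ENNReal.ofReal_pos.2 hp0).ne'
  have hpR : (ENNReal.ofReal p).toReal = p := ENNReal.toReal_ofReal hp0.le
  have hnorm : eLpNorm (fun w => (f w : ℂ)) (ENNReal.ofReal p) (weightedMu ω q) =
      (∫⁻ w, ENNReal.ofReal (f w) ^ p ∂(weightedMu ω q)) ^ (1 / p) := by
    rw [eLpNorm_eq_lintegral_rpow_enorm_toReal hpE ENNReal.ofReal_ne_top, hpR]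
    simp only [enorm_ofReal_of_nonneg (hf0 _)]
  have hmem : MemLp (fun w => (f w : ℂ)) (ENNReal.ofReal p) (weightedMu ω q) := by
    refine ⟨?_, ?_⟩
    · exact ((Complex.measurable_ofReal.comp_aemeasurable hf).mono_ac
        (weightedMu_absolutelyContinuous ω q)).aestronglyMeasurable
    · rw [hnorm]
      exact ENNReal.rpow_lt_top_of_nonneg (by positivity) hfin
  have hae := hT _ hmem
  have hle := hC _ hmem
  rw [hnorm, eLpNorm_eq_lintegral_rpow_enorm_toReal hpE ENNReal.ofReal_ne_top, hpR] at hle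
  have hle' := ENNReal.rpow_le_rpow hle hp0.le
  rw [ENNReal.mul_rpow_of_nonneg _ _ hp0.le, ← ENNReal.rpow_mul, ← ENNReal.rpow_mul,
    one_div_mul_cancel hp0.ne', ENNReal.rpow_one, ENNReal.rpow_one] at hle'
  refine le_trans ?_ hle'
  refine le_trans ?_ (setLIntegral_le_lintegral F _)
  rw [mul_comm, ← setLIntegral_const]
  refine lintegral_mono_ae ?_
  filter_upwards [ae_restrict_mem hF,
    ae_restrict_of_ae ((weightedMu_absolutelyContinuous ω Q).ae_le hae),
    ae_restrict_of_ae ((weightedMu_absolutelyContinuous ω Q).ae_le ae_mem_unitBall)]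
    with z hzF hz hzB
  exact ENNReal.rpow_le_rpow (le_enorm_opT hf0 hfE hu hm (hk z ⟨hzF, hzB⟩) hz) hp0.le

/-- Testing on `(1 - |w|²)^t` restricted to `E`. -/
lemma weightedMu_mul_muW_rpow_le (hp : 1 < p) (hω : AEMeasurable ω (mu N))
    (hT : ∀ f : CSpace N → ℂ, MemLp f (ENNReal.ofReal p) (weightedMu ω q) →
      ∀ᵐ z ∂(mu N), Integrable (integrandT a b q f z) (muW N q))
    {C : NNReal} (hC : ∀ f : CSpace N → ℂ, MemLp f (ENNReal.ofReal p) (weightedMu ω q) →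
      eLpNorm (opT a b q f) (ENNReal.ofReal p) (weightedMu ω Q)
        ≤ C * eLpNorm f (ENNReal.ofReal p) (weightedMu ω q))
    {E F : Set (CSpace N)} (hE : MeasurableSet E) (hF : MeasurableSet F)
    {u : ℂ} (hu : ‖u‖ = 1) {m : ℝ} (hm : 0 ≤ m)
    (hk : ∀ z ∈ F ∩ unitBall N, ∀ w ∈ E ∩ unitBall N, m ≤ (u * kernel a z w).re)
    (t : ℝ) (hfin : weightedMu ω (q + p * t) E ≠ ∞) :
    weightedMu ω Q F * (ENNReal.ofReal m * muW N (b + t) E) ^ p ≤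
      (C : ℝ≥0∞) ^ p * weightedMu ω (q + p * t) E := by
  have hp0 : 0 < p := by linarith
  set f : CSpace N → ℝ := (E ∩ unitBall N).indicator fun w => (1 - ‖w‖ ^ 2) ^ t with hfdef
  have hfm : Measurable f :=
    Measurable.indicator (by measurability) (hE.inter measurableSet_ball)
  have hf0 : ∀ w, 0 ≤ f w := fun w =>
    Set.indicator_nonneg (fun w hw => Real.rpow_nonneg (one_sub_norm_sq_pos hw.2).le _) w
  have hfE : ∀ w ∉ E, f w = 0 := fun w hw => Set.indicator_of_notMem (fun h => hw h.1) _
  have h1 : ∫⁻ w, ENNReal.ofReal (f w) ∂(muW N b) = muW N (b + t) E := by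
    rw [muW_apply _ hE, lintegral_muW, ← lintegral_indicator hE]
    refine lintegral_congr_ae ?_
    filter_upwards [ae_mem_unitBall] with w hw
    have hx := one_sub_norm_sq_pos hw
    by_cases hwE : w ∈ E
    · rw [hfdef, Set.indicator_of_mem (Set.mem_inter hwE hw), Set.indicator_of_mem hwE,
        ← ENNReal.ofReal_mul (by positivity), Real.rpow_add hx]
    · rw [hfE w hwE, Set.indicator_of_notMem hwE]; simp
  have h2 : ∫⁻ w, ENNReal.ofReal (f w) ^ p ∂(weightedMu ω q) = weightedMu ω (q + p * t) E := by
    rw [weightedMu_apply _ _ hE, lintegral_weightedMu hω q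
      (hfm.ennreal_ofReal.pow_const p).aemeasurable]
    refine lintegral_congr_ae ?_
    filter_upwards [ae_mem_unitBall] with w hw
    have hx := one_sub_norm_sq_pos hw
    by_cases hwE : w ∈ E
    · rw [hfdef, Set.indicator_of_mem (Set.mem_inter hwE hw), Set.indicator_of_mem hwE,
        ENNReal.ofReal_rpow_of_nonneg (by positivity) hp0.le, ← Real.rpow_mul hx.le,
        mul_comm t p, Real.rpow_add hx, ENNReal.ofReal_mul (by positivity)]
      ring
    · rw [hfE w hwE, Set.indicator_of_notMem hwE]
      simp [ENNReal.zero_rpow_of_pos hp0]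
  have := weightedMu_mul_rpow_le hp hT hC hfm.aemeasurable hf0 hF hfE hu hm hk (by rwa [h2])
  rwa [h1, h2] at this

/-- The measure `ω^{-1/(p-1)} dμ_{q + p'(b-q)}`. -/
def dualMu (b p q : ℝ) (ω : CSpace N → ℝ) : Measure (CSpace N) :=
  (muW N (q + p / (p - 1) * (b - q))).withDensity
    fun z => ENNReal.ofReal (ω z) ^ (-1 / (p - 1))

lemma dualMu_apply (b p q : ℝ) (ω : CSpace N → ℝ) {s : Set (CSpace N)} (hs : MeasurableSet s) :
    dualMu b p q ω s = ∫⁻ z, ENNReal.ofReal ((1 - ‖z‖ ^ 2) ^ (q + p / (p - 1) * (b - q))) *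
      s.indicator (fun z => ENNReal.ofReal (ω z) ^ (-1 / (p - 1))) z ∂(mu N) := by
  rw [dualMu, withDensity_apply _ hs, ← lintegral_indicator hs, lintegral_muW]

lemma sigmaFinite_dualMu (hpos : ∀ᵐ z ∂(mu N), 0 < ω z) (b p q : ℝ) :
    SigmaFinite (dualMu b p q ω) := by
  refine SigmaFinite.withDensity_of_ne_top ((muW_absolutelyContinuous _).ae_le ?_)
  filter_upwards [hpos] with z hz
  rw [ENNReal.ofReal_rpow_of_pos hz]
  exact ENNReal.ofReal_ne_top

/-- Testing on `ω^{-1/(p-1)} (1 - |w|²)^{(b-q)/(p-1)}` restricted to a set of finite dual measure. -/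
lemma weightedMu_mul_dualMu_rpow_le_of_ne_top (hp : 1 < p) (hω : AEMeasurable ω (mu N))
    (hpos : ∀ᵐ z ∂(mu N), 0 < ω z)
    (hT : ∀ f : CSpace N → ℂ, MemLp f (ENNReal.ofReal p) (weightedMu ω q) →
      ∀ᵐ z ∂(mu N), Integrable (integrandT a b q f z) (muW N q))
    {C : NNReal} (hC : ∀ f : CSpace N → ℂ, MemLp f (ENNReal.ofReal p) (weightedMu ω q) →
      eLpNorm (opT a b q f) (ENNReal.ofReal p) (weightedMu ω Q)
        ≤ C * eLpNorm f (ENNReal.ofReal p) (weightedMu ω q))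
    {E F : Set (CSpace N)} (hE : MeasurableSet E) (hF : MeasurableSet F)
    {u : ℂ} (hu : ‖u‖ = 1) {m : ℝ} (hm : 0 ≤ m)
    (hk : ∀ z ∈ F ∩ unitBall N, ∀ w ∈ E ∩ unitBall N, m ≤ (u * kernel a z w).re)
    (hfin : dualMu b p q ω E ≠ ∞) :
    weightedMu ω Q F * ENNReal.ofReal m ^ p * dualMu b p q ω E ^ (p - 1) ≤ (C : ℝ≥0∞) ^ p := by
  have hp0 : 0 < p := by linarith
  have hp1 : 0 < p - 1 := by linarith
  -- The exponents make f dμ_b and f^p ω dμ_q both equal to the dual measure on E, so cancelling one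
  -- factor leaves the power p - 1. The absolute value gives nonnegativity everywhere and changes
  -- nothing almost everywhere.
  set g : CSpace N → ℝ := fun w => |ω w| ^ (-1 / (p - 1)) * (1 - ‖w‖ ^ 2) ^ ((b - q) / (p - 1))
    with hgdef
  have hg : ∀ w, 0 < ω w →
      g w = ω w ^ (-1 / (p - 1)) * (1 - ‖w‖ ^ 2) ^ ((b - q) / (p - 1)) := fun w hw => by
    simp only [hgdef, abs_of_pos hw]
  set f : CSpace N → ℝ := (E ∩ unitBall N).indicator g with hfdef
  have hgm : AEMeasurable g (mu N) := by
    refine AEMeasurable.mul ?_ (Measurable.aemeasurable (by measurability))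
    exact (measurable_norm.comp_aemeasurable hω).pow_const _
  have hfm : AEMeasurable f (mu N) := hgm.indicator (hE.inter measurableSet_ball)
  have hf0 : ∀ w, 0 ≤ f w := fun w =>
    Set.indicator_nonneg (fun w hw => mul_nonneg (by positivity)
      (Real.rpow_nonneg (one_sub_norm_sq_pos hw.2).le _)) w
  have hfE : ∀ w ∉ E, f w = 0 := fun w hw => Set.indicator_of_notMem (fun h => hw h.1) _
  have h1 : ∫⁻ w, ENNReal.ofReal (f w) ∂(muW N b) = dualMu b p q ω E := by
    rw [dualMu_apply _ _ _ _ hE, lintegral_muW]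
    refine lintegral_congr_ae ?_
    filter_upwards [ae_mem_unitBall, hpos] with w hw hωw
    have hx := one_sub_norm_sq_pos hw
    by_cases hwE : w ∈ E
    · have hexp : q + p / (p - 1) * (b - q) = b + (b - q) / (p - 1) := by
        field_simp; ring
      rw [hfdef, Set.indicator_of_mem (Set.mem_inter hwE hw), Set.indicator_of_mem hwE, hg w hωw,
        ENNReal.ofReal_rpow_of_pos hωw, hexp, Real.rpow_add hx,
        ← ENNReal.ofReal_mul (by positivity), ← ENNReal.ofReal_mul (by positivity)]
      congr 1; ring
    · rw [hfE w hwE, Set.indicator_of_notMem hwE]; simp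
  have h2 : ∫⁻ w, ENNReal.ofReal (f w) ^ p ∂(weightedMu ω q) = dualMu b p q ω E := by
    rw [dualMu_apply _ _ _ _ hE, lintegral_weightedMu hω q (hfm.ennreal_ofReal.pow_const p)]
    refine lintegral_congr_ae ?_
    filter_upwards [ae_mem_unitBall, hpos] with w hw hωw
    have hx := one_sub_norm_sq_pos hw
    by_cases hwE : w ∈ E
    · have hexp : q + p / (p - 1) * (b - q) = q + (b - q) / (p - 1) * p := by
        field_simp
      have hexp2 : ω w ^ (-1 / (p - 1)) = ω w * (ω w ^ (-1 / (p - 1))) ^ p := by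
        rw [← Real.rpow_mul hωw.le]
        nth_rewrite 2 [← Real.rpow_one (ω w)]
        rw [← Real.rpow_add hωw]
        congr 1
        field_simp; ring
      rw [hfdef, Set.indicator_of_mem (Set.mem_inter hwE hw), Set.indicator_of_mem hwE, hg w hωw,
        ENNReal.ofReal_rpow_of_pos hωw, hexp, Real.rpow_add hx,
        ENNReal.ofReal_rpow_of_nonneg (by positivity) hp0.le,
        Real.mul_rpow (by positivity) (by positivity), ← ENNReal.ofReal_mul hωw.le,
        ← ENNReal.ofReal_mul (by positivity), ← ENNReal.ofReal_mul (by positivity),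
        Real.rpow_mul hx.le]
      congr 1
      linear_combination (-((1 - ‖w‖ ^ 2) ^ q * ((1 - ‖w‖ ^ 2) ^ ((b - q) / (p - 1))) ^ p)) * hexp2
    · rw [hfE w hwE, Set.indicator_of_notMem hwE]
      simp [ENNReal.zero_rpow_of_pos hp0]
  have key := weightedMu_mul_rpow_le hp hT hC hfm hf0 hF hfE hu hm hk (by rwa [h2])
  rw [h1, h2, ENNReal.mul_rpow_of_nonneg _ _ hp0.le] at key
  rcases eq_or_ne (dualMu b p q ω E) 0 with h0 | h0
  · rw [h0, ENNReal.zero_rpow_of_pos hp1, mul_zero]; exact zero_le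
  rw [← ENNReal.mul_le_mul_iff_left h0 hfin]
  refine le_trans (le_of_eq ?_) key
  have : dualMu b p q ω E ^ p = dualMu b p q ω E ^ (p - 1) * dualMu b p q ω E := by
    conv_rhs => rw [← ENNReal.rpow_one (dualMu b p q ω E), ← ENNReal.rpow_mul, one_mul]
    rw [← ENNReal.rpow_add _ _ h0 hfin]; congr 1; ring
  rw [this]; ring

/-- The finiteness assumption on the dual measure of E is removed by exhaustion: positivity of ω
makes that measure σ-finite, and the kernel bound passes to subsets of E. The condition C ≠ 0 allows
the inequality to be solved for the dual mass in `ℝ≥0∞`, even when the other factor is 0 or ∞. -/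
lemma weightedMu_mul_dualMu_rpow_le (hp : 1 < p) (hω : AEMeasurable ω (mu N))
    (hpos : ∀ᵐ z ∂(mu N), 0 < ω z)
    (hT : ∀ f : CSpace N → ℂ, MemLp f (ENNReal.ofReal p) (weightedMu ω q) →
      ∀ᵐ z ∂(mu N), Integrable (integrandT a b q f z) (muW N q))
    {C : NNReal} (hC : ∀ f : CSpace N → ℂ, MemLp f (ENNReal.ofReal p) (weightedMu ω q) →
      eLpNorm (opT a b q f) (ENNReal.ofReal p) (weightedMu ω Q)
        ≤ C * eLpNorm f (ENNReal.ofReal p) (weightedMu ω q)) (hC0 : C ≠ 0)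
    {E F : Set (CSpace N)} (hE : MeasurableSet E) (hF : MeasurableSet F)
    {u : ℂ} (hu : ‖u‖ = 1) {m : ℝ} (hm : 0 ≤ m)
    (hk : ∀ z ∈ F ∩ unitBall N, ∀ w ∈ E ∩ unitBall N, m ≤ (u * kernel a z w).re) :
    weightedMu ω Q F * ENNReal.ofReal m ^ p * dualMu b p q ω E ^ (p - 1) ≤ (C : ℝ≥0∞) ^ p := by
  have hp0 : 0 < p := by linarith
  have hp1 : 0 < p - 1 := by linarith
  have := sigmaFinite_dualMu hpos b p q
  set A := weightedMu ω Q F * ENNReal.ofReal m ^ p with hA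
  have hCp0 : (C : ℝ≥0∞) ^ p ≠ 0 := by
    simp [ENNReal.rpow_eq_zero_iff, hC0]
  have hCpT : (C : ℝ≥0∞) ^ p ≠ ∞ := ENNReal.rpow_ne_top_of_nonneg hp0.le ENNReal.coe_ne_top
  have conv : ∀ x : ℝ≥0∞, A * x ^ (p - 1) ≤ (C : ℝ≥0∞) ^ p ↔
      x ≤ ((C : ℝ≥0∞) ^ p / A) ^ (1 / (p - 1)) := by
    intro x
    rw [mul_comm, ← ENNReal.le_div_iff_mul_le (Or.inr hCp0) (Or.inr hCpT),
      one_div, ENNReal.le_rpow_inv_iff hp1]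
  rw [conv]
  refine le_of_forall_lt fun r hr => ?_
  obtain ⟨E', hE'm, hE'E, hr', hfin⟩ := Measure.exists_subset_measure_lt_top hE hr
  refine hr'.trans_le ((conv _).1 ?_)
  exact weightedMu_mul_dualMu_rpow_le_of_ne_top hp hω hpos hT hC hE'm hF hu hm
    (fun z hz w hw => hk z hz w ⟨hE'E hw.1, hw.2⟩) hfin.ne

end TestFunctions

/-! ### Global consequences of testing near the origin. -/

section Global

variable {N : ℕ} {a b p q Q : ℝ} {ω : CSpace N → ℝ}

/-- The half-plane estimate at k = 1: if one variable has norm below ε, then |⟨z, w⟩| ≤ ε for every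
position of the other. -/
lemma exists_half_le_re_kernel (N : ℕ) (a : ℝ) : ∃ ε : ℝ, 0 < ε ∧ ε < 1 ∧ ∃ u : ℂ, ‖u‖ = 1 ∧
    ∀ z ∈ unitBall N, ∀ w ∈ unitBall N, (z ∈ ball 0 ε ∨ w ∈ ball 0 ε) →
      1 / 2 ≤ (u * kernel a z w).re := by
  obtain ⟨ε, hε, hε1, h⟩ := exists_half_le_re_one_div_cpow ((N : ℝ) + 1 + a)
  obtain ⟨u, hu, h⟩ := h 1 (by simp)
  refine ⟨ε, hε, hε1, u, hu, fun z hz w hw hzw => ?_⟩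
  have hz1 : ‖z‖ < 1 := by simpa using hz
  have hw1 : ‖w‖ < 1 := by simpa using hw
  have h1 : ‖herm z w‖ ≤ ε := by
    refine (norm_herm_le z w).trans ?_
    rcases hzw with h | h
    · have : ‖z‖ < ε := by simpa using h
      nlinarith [norm_nonneg z, norm_nonneg w]
    · have : ‖w‖ < ε := by simpa using h
      nlinarith [norm_nonneg z, norm_nonneg w]
  simpa [kernel] using h (1 - herm z w) (by simpa using h1)

lemma density_le {ε : ℝ} (hε : 0 < ε) (hε1 : ε < 1) (r : ℝ) {z : CSpace N} (hz : z ∈ ball 0 ε) :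
    (1 - ‖z‖ ^ 2) ^ r ≤ max 1 ((1 - ε ^ 2) ^ r) := by
  have hz' : ‖z‖ < ε := by simpa using hz
  have h1 : 1 - ε ^ 2 ≤ 1 - ‖z‖ ^ 2 := by nlinarith [norm_nonneg z]
  have h2 : 0 < 1 - ε ^ 2 := by nlinarith
  rcases le_total 0 r with h | h
  · exact (Real.rpow_le_one (by linarith) (by linarith [sq_nonneg ‖z‖]) h).trans (le_max_left _ _)
  · exact (Real.rpow_le_rpow_of_nonpos h2 h1 h).trans (le_max_right _ _)

lemma weightedMu_ball_lt_top (hω : IsWeight ω) {ε : ℝ} (hε : 0 < ε) (hε1 : ε < 1) (r : ℝ) :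
    weightedMu ω r (ball 0 ε) < ∞ := by
  have hint : IntegrableOn ω (ball 0 ε) (lebesgue N) :=
    (hω.locallyIntegrable.integrableOn_compact_subset (closedBall_subset_ball hε1)
      (isCompact_closedBall 0 ε)).mono_set ball_subset_closedBall
  rw [weightedMu_apply _ _ measurableSet_ball]
  calc ∫⁻ z, ENNReal.ofReal ((1 - ‖z‖ ^ 2) ^ r) *
        (ball 0 ε).indicator (fun z => ENNReal.ofReal (ω z)) z ∂(mu N)
      ≤ ∫⁻ z, ENNReal.ofReal (max 1 ((1 - ε ^ 2) ^ r)) *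
        (ball 0 ε).indicator (fun z => ENNReal.ofReal (ω z)) z ∂(mu N) := by
        refine lintegral_mono fun z => ?_
        by_cases hz : z ∈ ball 0 ε
        · gcongr
          exact density_le hε hε1 r hz
        · simp [Set.indicator_of_notMem hz]
    _ = ENNReal.ofReal (max 1 ((1 - ε ^ 2) ^ r)) *
          ∫⁻ z in ball 0 ε, ENNReal.ofReal (ω z) ∂(mu N) := by
        rw [lintegral_const_mul' _ _ ENNReal.ofReal_ne_top, lintegral_indicator measurableSet_ball]
    _ < ∞ := by
        refine ENNReal.mul_lt_top ENNReal.ofReal_lt_top ?_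
        rw [mu, Measure.restrict_smul, lintegral_smul_measure, smul_eq_mul]
        refine ENNReal.mul_lt_top (ENNReal.inv_lt_top.2 (lebesgue_unitBall_pos N)) ?_
        refine lt_of_le_of_lt ?_ hint.lintegral_lt_top
        exact lintegral_mono' (Measure.restrict_mono le_rfl Measure.restrict_le_self) le_rfl

lemma muW_ball_ne_zero {ε : ℝ} (hε : 0 < ε) (hε1 : ε ≤ 1) (r : ℝ) :
    muW N r (ball 0 ε) ≠ 0 := fun h =>
  (mu_ball_pos hε hε1).ne' (mu_absolutelyContinuous_muW r h)

/-- If the weight vanished identically, `T` would have to be defined on all measurable functions. -/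
lemma weightedMu_ne_zero (hN : 1 ≤ N)
    (hT : ∀ f : CSpace N → ℂ, MemLp f (ENNReal.ofReal p) (weightedMu ω q) →
      ∀ᵐ z ∂(mu N), Integrable (integrandT a b q f z) (muW N q)) :
    weightedMu ω q ≠ 0 := by
  intro h0
  obtain ⟨ε, hε, hε1, u, hu, hk⟩ := exists_half_le_re_kernel N a
  -- Under the zero measure f has norm 0, yet it is not μ_b-integrable at the origin, while
  -- convergence of Tf(z) at one z near 0 would make it so.
  set f : CSpace N → ℝ := fun w => (‖w‖ ^ (2 * N))⁻¹ with hf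
  have hae := hT (fun w => (f w : ℂ)) (by
    rw [h0]; exact ⟨aestronglyMeasurable_zero_measure _, by simp⟩)
  have hfr : ∃ᵐ z ∂(mu N), z ∈ ball 0 ε := by
    rw [frequently_ae_mem_iff]
    exact (mu_ball_pos hε hε1.le).ne'
  obtain ⟨z, ⟨hzε, hz⟩, hzB⟩ := ((hfr.and_eventually hae).and_eventually ae_mem_unitBall).exists
  have hle := le_enorm_opT (E := Set.univ) (m := 1 / 2) (a := a) (b := b) (q := q) (f := f)
    (fun w => by positivity) (by simp) hu (by norm_num)
    (fun w hw => hk z hzB w hw.2 (Or.inl hzε)) hz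
  have hfin : ∫⁻ w, ENNReal.ofReal (f w) ∂(muW N b) ≠ ∞ := by
    intro h
    rw [h, ENNReal.mul_top (by simp)] at hle
    exact absurd hle (by simp)
  rw [lintegral_muW] at hfin
  -- A lower bound for the density on |w| < 1/2, valid for either sign of b.
  set δ : ℝ := min 1 ((3 / 4) ^ b) with hδ
  have hδ0 : 0 < δ := lt_min one_pos (by positivity)
  have hlow : ∀ w : CSpace N, w ∈ ball 0 (1 / 2) → δ ≤ (1 - ‖w‖ ^ 2) ^ b := by
    intro w hw
    have hw' : ‖w‖ < 1 / 2 := by simpa using hw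
    have h1 : 3 / 4 ≤ 1 - ‖w‖ ^ 2 := by nlinarith [norm_nonneg w]
    rcases le_total 0 b with h | h
    · exact (min_le_right _ _).trans (Real.rpow_le_rpow (by norm_num) h1 h)
    · exact (min_le_left _ _).trans
        (Real.one_le_rpow_of_pos_of_le_one_of_nonpos (by linarith) (by linarith [sq_nonneg ‖w‖]) h)
  have hfin2 : ∫⁻ w in ball 0 (1 / 2), ENNReal.ofReal (f w) ∂(mu N) ≠ ∞ := by
    intro h
    refine hfin (top_le_iff.1 ?_)
    calc ∞ = ENNReal.ofReal δ * ∫⁻ w in ball 0 (1 / 2), ENNReal.ofReal (f w) ∂(mu N) := by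
          rw [h, ENNReal.mul_top (ENNReal.ofReal_pos.2 hδ0).ne']
      _ = ∫⁻ w in ball 0 (1 / 2), ENNReal.ofReal δ * ENNReal.ofReal (f w) ∂(mu N) := by
          rw [lintegral_const_mul' _ _ ENNReal.ofReal_ne_top]
      _ ≤ ∫⁻ w in ball 0 (1 / 2),
            ENNReal.ofReal ((1 - ‖w‖ ^ 2) ^ b) * ENNReal.ofReal (f w) ∂(mu N) := by
          refine setLIntegral_mono' measurableSet_ball fun w hw => ?_
          gcongr
          exact hlow w hw
      _ ≤ _ := setLIntegral_le_lintegral _ _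
  rw [mu, Measure.restrict_smul, lintegral_smul_measure, smul_eq_mul,
    Measure.restrict_restrict measurableSet_ball,
    Set.inter_eq_left.2 (ball_subset_ball (by norm_num : (1 / 2 : ℝ) ≤ 1))] at hfin2
  refine not_integrableOn_norm_rpow hN (show (0 : ℝ) < 1 / 2 by norm_num) ⟨?_, ?_⟩
  · exact Measurable.aestronglyMeasurable (by fun_prop)
  · rw [hasFiniteIntegral_iff_ofReal (ae_of_all _ fun w => by positivity)]
    refine lt_top_iff_ne_top.2 fun h => hfin2 ?_
    rw [h, ENNReal.mul_top (ENNReal.inv_ne_zero.2 (lebesgue_unitBall_lt_top N).ne)]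

/-- The indicator of a small ball has finite norm by local integrability, and its image is bounded
below on all of 𝔹. -/
lemma weightedMu_univ_lt_top (hp : 1 < p) (hω : IsWeight ω)
    (hT : ∀ f : CSpace N → ℂ, MemLp f (ENNReal.ofReal p) (weightedMu ω q) →
      ∀ᵐ z ∂(mu N), Integrable (integrandT a b q f z) (muW N q))
    {C : NNReal} (hC : ∀ f : CSpace N → ℂ, MemLp f (ENNReal.ofReal p) (weightedMu ω q) →
      eLpNorm (opT a b q f) (ENNReal.ofReal p) (weightedMu ω Q)
        ≤ C * eLpNorm f (ENNReal.ofReal p) (weightedMu ω q)) :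
    weightedMu ω Q Set.univ < ∞ := by
  have hp0 : 0 < p := by linarith
  obtain ⟨ε, hε, hε1, u, hu, hk⟩ := exists_half_le_re_kernel N a
  have hfin := weightedMu_ball_lt_top hω hε hε1 (q + p * 0)
  have key := weightedMu_mul_muW_rpow_le hp hω.aemeasurable hT hC (E := ball 0 ε)
    (F := Set.univ) measurableSet_ball MeasurableSet.univ hu (by norm_num)
    (fun z hz w hw => hk z hz.2 w hw.2 (Or.inr hw.1)) 0 hfin.ne
  have hpos : (ENNReal.ofReal (1 / 2) * muW N (b + 0) (ball 0 ε)) ^ p ≠ 0 := by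
    have h1 := muW_ball_ne_zero (N := N) hε hε1.le (b + 0)
    have h2 : ENNReal.ofReal (1 / 2) ≠ 0 := by simp
    simp only [ne_eq, ENNReal.rpow_eq_zero_iff, mul_eq_zero, h1, h2, hp0.not_gt]
    simp
  by_contra hcon
  rw [not_lt, top_le_iff] at hcon
  rw [hcon, ENNReal.top_mul hpos] at key
  exact absurd key (not_le.2 (ENNReal.mul_lt_top
    (ENNReal.rpow_lt_top_of_nonneg hp0.le ENNReal.coe_ne_top) hfin))

/-- A function living where ω vanishes has norm zero, so its image vanishes ω-almost everywhere.
Applied to a small ball, this shows that ω cannot vanish a.e. there without vanishing a.e. on 𝔹.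
Applied to the zero set of ω, whose image is bounded below on that ball, it shows that the zero set
is null. -/
lemma ae_weight_pos (hN : 1 ≤ N) (hp : 1 < p) (hω : IsWeight ω)
    (hT : ∀ f : CSpace N → ℂ, MemLp f (ENNReal.ofReal p) (weightedMu ω q) →
      ∀ᵐ z ∂(mu N), Integrable (integrandT a b q f z) (muW N q))
    {C : NNReal} (hC : ∀ f : CSpace N → ℂ, MemLp f (ENNReal.ofReal p) (weightedMu ω q) →
      eLpNorm (opT a b q f) (ENNReal.ofReal p) (weightedMu ω Q)
        ≤ C * eLpNorm f (ENNReal.ofReal p) (weightedMu ω q)) :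
    ∀ᵐ z ∂(mu N), 0 < ω z := by
  have hp0 : 0 < p := by linarith
  have hωm := hω.aemeasurable
  obtain ⟨ε, hε, hε1, u, hu, hk⟩ := exists_half_le_re_kernel N a
  -- The null sets of ω dμ_r do not depend on r, which allows passing between q and Q.
  have hzero : ∀ r r' s, weightedMu ω r s = 0 → weightedMu ω r' s = 0 := fun r r' s h => by
    rwa [weightedMu_apply_eq_zero_iff hωm] at h ⊢
  have hhalf : ENNReal.ofReal (1 / 2) ≠ 0 := by simp
  have hball : weightedMu ω Q (ball 0 ε) ≠ 0 := by
    intro h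
    have h0 : weightedMu ω (q + p * 0) (ball 0 ε) = 0 := hzero _ _ _ h
    have key := weightedMu_mul_muW_rpow_le hp hω.aemeasurable hT hC (E := ball 0 ε)
      (F := Set.univ) measurableSet_ball MeasurableSet.univ hu (by norm_num)
      (fun z hz w hw => hk z hz.2 w hw.2 (Or.inr hw.1)) 0 (by rw [h0]; simp)
    rw [h0, mul_zero, nonpos_iff_eq_zero, mul_eq_zero] at key
    have h1 := muW_ball_ne_zero (N := N) hε hε1.le (b + 0)
    rcases key with h2 | h2
    · exact weightedMu_ne_zero hN hT (Measure.measure_univ_eq_zero.1 (hzero _ _ _ h2))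
    · simp only [ENNReal.rpow_eq_zero_iff, mul_eq_zero, h1, hhalf, hp0.not_gt] at h2
      simp at h2
  set Z : Set (CSpace N) := {z | ω z ≤ 0} with hZ
  have hZm : NullMeasurableSet Z (mu N) := nullMeasurableSet_le hωm aemeasurable_const
  have hfm : AEMeasurable (Z.indicator fun _ => (1 : ℝ)) (mu N) :=
    (aemeasurable_indicator_const_iff (1 : ℝ)).2 hZm
  have hI : ∫⁻ w, ENNReal.ofReal (Z.indicator (fun _ => (1 : ℝ)) w) ^ p ∂(weightedMu ω q) = 0 := by
    rw [lintegral_weightedMu hωm q (hfm.ennreal_ofReal.pow_const p)]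
    refine (lintegral_congr fun w => ?_).trans lintegral_zero
    by_cases hw : w ∈ Z
    · simp [ENNReal.ofReal_of_nonpos hw]
    · simp [Set.indicator_of_notMem hw, hp0]
  have key := weightedMu_mul_rpow_le hp hT hC hfm
    (fun w => Set.indicator_nonneg (fun _ _ => zero_le_one) w) (E := Set.univ) (F := ball 0 ε)
    measurableSet_ball (by simp) hu (m := 1 / 2) (by norm_num)
    (fun z hz w hw => hk z hz.2 w hw.2 (Or.inl hz.1)) (by rw [hI]; simp)
  rw [hI, mul_zero, nonpos_iff_eq_zero, mul_eq_zero] at key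
  rcases key with h | h
  · exact absurd h hball
  · simp only [ENNReal.rpow_eq_zero_iff, mul_eq_zero, hhalf, hp0.not_gt, false_or, and_false,
      or_false, and_true, hp0] at h
    rw [lintegral_eq_zero_iff' (aemeasurable_muW hfm b).ennreal_ofReal] at h
    filter_upwards [(mu_absolutelyContinuous_muW b).ae_le h] with z hz
    by_contra hcon
    have hzZ : z ∈ Z := not_lt.1 hcon
    simp [Set.indicator_of_mem hzZ] at hz

/-- The dual test with E everything and F a small ball, which has positive ω-mass because ω > 0 a.e.
-/
lemma dualMu_univ_lt_top (hN : 1 ≤ N) (hp : 1 < p) (hω : IsWeight ω)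
    (hT : ∀ f : CSpace N → ℂ, MemLp f (ENNReal.ofReal p) (weightedMu ω q) →
      ∀ᵐ z ∂(mu N), Integrable (integrandT a b q f z) (muW N q))
    {C : NNReal} (hC : ∀ f : CSpace N → ℂ, MemLp f (ENNReal.ofReal p) (weightedMu ω q) →
      eLpNorm (opT a b q f) (ENNReal.ofReal p) (weightedMu ω Q)
        ≤ C * eLpNorm f (ENNReal.ofReal p) (weightedMu ω q)) (hC0 : C ≠ 0) :
    dualMu b p q ω Set.univ < ∞ := by
  have hp0 : 0 < p := by linarith
  have hp1 : 0 < p - 1 := by linarith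
  have hpos := ae_weight_pos hN hp hω hT hC
  obtain ⟨ε, hε, hε1, u, hu, hk⟩ := exists_half_le_re_kernel N a
  have key := weightedMu_mul_dualMu_rpow_le hp hω.aemeasurable hpos hT hC hC0 (E := Set.univ)
    (F := ball 0 ε) MeasurableSet.univ measurableSet_ball hu (m := 1 / 2) (by norm_num)
    (fun z hz w hw => hk z hz.2 w hw.2 (Or.inl hz.1))
  have hball : weightedMu ω Q (ball 0 ε) ≠ 0 := by
    rw [ne_eq, weightedMu_apply_eq_zero_iff hω.aemeasurable, Set.inter_comm,
      measure_inter_conull]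
    · exact (mu_ball_pos hε hε1.le).ne'
    · refine measure_mono_null ?_ hpos
      intro z hz hz'
      exact hz (ENNReal.ofReal_pos.2 hz').ne'
  by_contra hcon
  rw [not_lt, top_le_iff] at hcon
  rw [hcon, ENNReal.top_rpow_of_pos hp1, ENNReal.mul_top, top_le_iff] at key
  · exact ENNReal.rpow_ne_top_of_nonneg hp0.le ENNReal.coe_ne_top key
  · refine mul_ne_zero hball ?_
    simp [ENNReal.rpow_eq_zero_iff, hp0.not_gt]

end Global

/-! ### Lower bound for μ_a of a pseudo-ball, by an inscribed polydisc. -/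

section LowerBound

lemma exists_linearIsometryEquiv_apply_zero {n : ℕ} {u : CSpace (n + 1)} (hu : ‖u‖ = 1) :
    ∃ U : CSpace (n + 1) ≃ₗᵢ[ℂ] CSpace (n + 1), ∀ w, U w 0 = herm w u := by
  have ho : Orthonormal ℂ (({0} : Set (Fin (n + 1))).domRestrict fun _ => u) := by
    refine ⟨fun _ => hu, fun i j hij => absurd (Subsingleton.elim i j) hij⟩
  obtain ⟨B, hB⟩ := ho.exists_orthonormalBasis_extension_of_card_eq (by simp)
  refine ⟨B.repr, fun w => ?_⟩
  rw [B.repr_apply_apply, hB 0 rfl]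
  rfl

/-- A polydisc of size `R` in the first coordinate and `√R` in the others, centred at
`(1 - 3R/8, 0, …, 0)`. -/
def carlesonPolydisc (n : ℕ) (R : ℝ) : Set (CSpace (n + 1)) :=
  {v | v 0 ∈ ball ((1 - 3 * R / 8 : ℝ) : ℂ) (R / 64) ∧
    ∀ i : Fin n, v i.succ ∈ ball (0 : ℂ) √(R / (64 * (n + 1)))}

lemma measurableSet_carlesonPolydisc (n : ℕ) (R : ℝ) : MeasurableSet (carlesonPolydisc n R) := by
  have h : ∀ i : Fin (n + 1), Measurable fun v : CSpace (n + 1) => v i := fun i => by fun_prop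
  have e : carlesonPolydisc n R =
      (fun v : CSpace (n + 1) => v 0) ⁻¹' ball ((1 - 3 * R / 8 : ℝ) : ℂ) (R / 64) ∩
      ⋂ i : Fin n, (fun v : CSpace (n + 1) => v i.succ) ⁻¹' ball 0 √(R / (64 * (n + 1))) := by
    ext v; simp [carlesonPolydisc]
  rw [e]
  exact (h 0 measurableSet_ball).inter
    (MeasurableSet.iInter fun i => h i.succ measurableSet_ball)

/-- The radial disc contributes R² and each of the n tangential ones R, hence R^{N+1} with N = n +
1. -/
lemma lebesgue_carlesonPolydisc (n : ℕ) {R : ℝ} (hR : 0 < R) :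
    lebesgue (n + 1) (carlesonPolydisc n R) =
      ENNReal.ofReal ((Real.pi / 64 ^ 2 * (Real.pi / (64 * (n + 1))) ^ n) * R ^ (n + 2)) := by
  rw [← (measurePreserving_toLp (n + 1)).measure_preimage
    (measurableSet_carlesonPolydisc n R).nullMeasurableSet]
  have e : WithLp.toLp 2 ⁻¹' carlesonPolydisc n R = Set.pi Set.univ (Fin.cons
      (ball ((1 - 3 * R / 8 : ℝ) : ℂ) (R / 64)) fun _ : Fin n =>
        ball (0 : ℂ) √(R / (64 * (n + 1)))) := by
    ext v
    simp [carlesonPolydisc, Fin.forall_fin_succ]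
  have hpi : (NNReal.pi : ℝ≥0∞) = ENNReal.ofReal Real.pi := by
    rw [← NNReal.coe_real_pi, ENNReal.ofReal_coe_nnreal]
  rw [e, volume_pi_pi, Fin.prod_univ_succ]
  simp only [Fin.cons_zero, Fin.cons_succ, Complex.volume_ball, Finset.prod_const,
    Finset.card_univ, Fintype.card_fin, hpi]
  rw [← ENNReal.ofReal_pow (by positivity), ← ENNReal.ofReal_pow (by positivity),
    ← ENNReal.ofReal_mul (by positivity), ← ENNReal.ofReal_mul (by positivity),
    ← ENNReal.ofReal_pow (by positivity), ← ENNReal.ofReal_mul (by positivity),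
    Real.sq_sqrt (by positivity)]
  congr 1
  have e2 : R / (64 * ((n : ℝ) + 1)) * Real.pi = Real.pi / (64 * (n + 1)) * R := by ring
  rw [e2, mul_pow]
  ring

lemma carlesonPolydisc_bounds {n : ℕ} {R : ℝ} (hR : 0 < R) (hR1 : R ≤ 1) {v : CSpace (n + 1)}
    (hv : v ∈ carlesonPolydisc n R) :
    R / 4 < 1 - ‖v‖ ∧ 1 - ‖v‖ < R / 2 ∧ ‖1 - v 0 / (‖v‖ : ℂ)‖ < R / 4 := by
  obtain ⟨h0, hi⟩ := hv
  rw [mem_ball, dist_eq_norm] at h0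
  set x : ℝ := 1 - 3 * R / 8 with hx
  have hx0 : 5 / 8 ≤ x := by linarith
  have hnx : ‖(x : ℂ)‖ = x := by rw [Complex.norm_real, Real.norm_of_nonneg (by linarith)]
  have h1 : ‖v 0‖ ≤ x + R / 64 := by
    have := norm_le_norm_add_norm_sub' (v 0) (x : ℂ); linarith
  have h2 : x - R / 64 ≤ ‖v 0‖ := by
    have := norm_le_norm_add_norm_sub' (x : ℂ) (v 0)
    rw [norm_sub_rev] at this; linarith
  have hsum : ∑ i : Fin n, ‖v i.succ‖ ^ 2 ≤ R / 64 := by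
    have hterm : ∀ i : Fin n, ‖v i.succ‖ ^ 2 ≤ R / (64 * (n + 1)) := fun i => by
      have h := hi i
      rw [mem_ball_zero_iff] at h
      have h3 := pow_le_pow_left₀ (norm_nonneg _) h.le 2
      rwa [Real.sq_sqrt (by positivity)] at h3
    refine (Finset.sum_le_sum fun i _ => hterm i).trans ?_
    simp only [Finset.sum_const, Finset.card_univ, Fintype.card_fin, nsmul_eq_mul]
    have hn : (0 : ℝ) ≤ n := Nat.cast_nonneg n
    rw [mul_div_assoc', div_le_div_iff₀ (by positivity) (by norm_num)]
    nlinarith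
  have hsum0 : 0 ≤ ∑ i : Fin n, ‖v i.succ‖ ^ 2 := by positivity
  have hnorm : ‖v‖ ^ 2 = ‖v 0‖ ^ 2 + ∑ i : Fin n, ‖v i.succ‖ ^ 2 := by
    rw [EuclideanSpace.norm_sq_eq, Fin.sum_univ_succ]
  have h3 : ‖v 0‖ ≤ ‖v‖ := by
    refine (pow_le_pow_iff_left₀ (norm_nonneg _) (norm_nonneg _) two_ne_zero).1 ?_; linarith
  -- Since 2|v 0| ≥ 1, the tangential square R/64 is absorbed as a linear increment.
  have h4 : ‖v‖ ≤ ‖v 0‖ + R / 64 := by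
    refine (pow_le_pow_iff_left₀ (norm_nonneg _) (by positivity) two_ne_zero).1 ?_
    nlinarith
  have hvpos : 1 / 2 < ‖v‖ := by linarith
  refine ⟨by linarith, by linarith, ?_⟩
  have hvne : (‖v‖ : ℂ) ≠ 0 := by
    have : ‖v‖ ≠ 0 := by linarith
    exact_mod_cast this
  have e : 1 - v 0 / (‖v‖ : ℂ) = (((‖v‖ - x : ℝ) : ℂ) - (v 0 - x)) / (‖v‖ : ℂ) := by
    field_simp; push_cast; ring
  have h5 : |‖v‖ - x| ≤ R / 32 := abs_le.2 ⟨by linarith, by linarith⟩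
  have h6 : ‖((‖v‖ - x : ℝ) : ℂ) - (v 0 - x)‖ ≤ R / 32 + R / 64 := by
    refine (norm_sub_le _ _).trans ?_
    rw [Complex.norm_real, Real.norm_eq_abs]; linarith
  rw [e, norm_div, Complex.norm_real, norm_norm, div_lt_iff₀ (by linarith)]
  nlinarith

/-- The isometry sends the direction of ζ to the first axis. The radial term is at most 3R/4 and the
angular one is below R/4. -/
lemma preimage_carlesonPolydisc_subset {n : ℕ} {ζ : CSpace (n + 1)} {R : ℝ} (hζ0 : ζ ≠ 0)
    (hζ : ζ ∈ unitBall (n + 1)) (hζR : 1 - ‖ζ‖ < R) (hR1 : R ≤ 1)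
    {U : CSpace (n + 1) ≃ₗᵢ[ℂ] CSpace (n + 1)} (hU : ∀ w, U w 0 = herm w (direction ζ)) :
    U ⁻¹' carlesonPolydisc n R ⊆ pseudoBall ζ R := by
  intro w hw
  have hζ1 : ‖ζ‖ < 1 := by simpa using hζ
  have hR : 0 < R := by linarith
  obtain ⟨h1, h2, h3⟩ := carlesonPolydisc_bounds hR hR1 hw
  rw [U.norm_map] at h1 h2 h3
  have hw0 : w ≠ 0 := by rintro rfl; simp at h2; linarith
  refine ⟨by simp only [mem_closedBall, dist_zero_right]; linarith, ?_⟩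
  rw [pseudoDist_eq hζ0 hw0]
  have e : herm (direction w) (direction ζ) = U w 0 / (‖w‖ : ℂ) := by
    rw [hU, direction, herm_smul_left]; push_cast; rw [div_eq_inv_mul]
  rw [norm_one_sub_herm_symm, e]
  have h4 : |‖ζ‖ - ‖w‖| ≤ 3 * R / 4 := abs_le.2 ⟨by linarith, by linarith⟩
  linarith

lemma exists_le_muW_pseudoBall_of_le_one {N : ℕ} (hN : 1 ≤ N) (a : ℝ) :
    ∃ k : ℝ, 0 < k ∧ ∀ (ζ : CSpace N) (R : ℝ), ζ ≠ 0 → ζ ∈ unitBall N → 1 - ‖ζ‖ < R → R ≤ 1 →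
      ENNReal.ofReal (k * R ^ ((N : ℝ) + 1 + a)) ≤ muW N a (pseudoBall ζ R) := by
  obtain ⟨n, rfl⟩ : ∃ n, N = n + 1 := ⟨N - 1, by omega⟩
  set K : ℝ := Real.pi / 64 ^ 2 * (Real.pi / (64 * (n + 1))) ^ n with hK
  have hKpos : 0 < K := by positivity
  set V := (lebesgue (n + 1) (unitBall (n + 1)))⁻¹ with hV
  have hV0 : V ≠ 0 := ENNReal.inv_ne_zero.2 (lebesgue_unitBall_lt_top _).ne
  have hVt : V ≠ ∞ := ENNReal.inv_ne_top.2 (lebesgue_unitBall_pos _).ne'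
  -- On the polydisc R/4 ≤ 1 - |v|² ≤ R; the lower end serves a ≥ 0 and the upper end a ≤ 0.
  set δ : ℝ := min ((1 / 4) ^ a) 1 with hδ
  have hδ0 : 0 < δ := lt_min (by positivity) one_pos
  refine ⟨δ * V.toReal * K, mul_pos (mul_pos hδ0 (ENNReal.toReal_pos hV0 hVt)) hKpos,
    fun ζ R hζ0 hζ hζR hR1 => ?_⟩
  have hζ1 : ‖ζ‖ < 1 := by simpa using hζ
  have hR : 0 < R := by linarith
  obtain ⟨U, hU⟩ := exists_linearIsometryEquiv_apply_zero (norm_direction hζ0)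
  have hP := measurableSet_carlesonPolydisc n R
  refine le_trans ?_ (measure_mono (preimage_carlesonPolydisc_subset hζ0 hζ hζR hR1 hU))
  rw [muW_preimage U a hP, muW_apply a hP]
  have hdens : ∀ v ∈ carlesonPolydisc n R,
      ENNReal.ofReal (δ * R ^ a) ≤ ENNReal.ofReal ((1 - ‖v‖ ^ 2) ^ a) := by
    intro v hv
    obtain ⟨h1, h2, -⟩ := carlesonPolydisc_bounds hR hR1 hv
    have hy1 : R / 4 ≤ 1 - ‖v‖ ^ 2 := by nlinarith [norm_nonneg v]
    have hy2 : 1 - ‖v‖ ^ 2 ≤ R := by nlinarith [norm_nonneg v]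
    refine ENNReal.ofReal_le_ofReal ?_
    have hRa : 0 < R ^ a := by positivity
    rcases le_total 0 a with h | h
    · calc δ * R ^ a ≤ (1 / 4) ^ a * R ^ a := by gcongr; exact min_le_left _ _
        _ = (R / 4) ^ a := by rw [← Real.mul_rpow (by norm_num) hR.le]; congr 1; ring
        _ ≤ _ := Real.rpow_le_rpow (by linarith) hy1 h
    · calc δ * R ^ a ≤ 1 * R ^ a := by gcongr; exact min_le_right _ _
        _ = R ^ a := one_mul _
        _ ≤ _ := Real.rpow_le_rpow_of_nonpos (by linarith) hy2 h
  refine le_trans (le_of_eq ?_) (setLIntegral_mono' hP hdens)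
  have hsub : carlesonPolydisc n R ⊆ unitBall (n + 1) := fun v hv => by
    obtain ⟨h1, -, -⟩ := carlesonPolydisc_bounds hR hR1 hv
    rw [mem_ball_zero_iff]; linarith
  rw [setLIntegral_const, mu_apply hP, Set.inter_eq_left.2 hsub, lebesgue_carlesonPolydisc n hR,
    ← hV, ← hK]
  nth_rewrite 2 [← ENNReal.ofReal_toReal hVt]
  rw [← ENNReal.ofReal_mul (by positivity), ← ENNReal.ofReal_mul (by positivity)]
  congr 1
  have hexp : R ^ (((n + 1 : ℕ) : ℝ) + 1 + a) = R ^ (n + 2) * R ^ a := by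
    rw [Real.rpow_add hR]
    congr 1
    rw [← Real.rpow_natCast]; congr 1; push_cast; ring
  rw [hexp]; ring

lemma pseudoBall_mono {N : ℕ} (ζ : CSpace N) {R R' : ℝ} (h : R ≤ R') :
    pseudoBall ζ R ⊆ pseudoBall ζ R' :=
  fun _ hw => ⟨hw.1, hw.2.trans_le h⟩

lemma exists_le_muW_pseudoBall {N : ℕ} (hN : 1 ≤ N) (a : ℝ) :
    ∃ k : ℝ, 0 < k ∧ ∀ (ζ : CSpace N) (R : ℝ), ζ ∈ unitBall N → 1 - ‖ζ‖ < R →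
      ENNReal.ofReal (k * min R 1 ^ ((N : ℝ) + 1 + a)) ≤ muW N a (pseudoBall ζ R) := by
  obtain ⟨k, hk, h⟩ := exists_le_muW_pseudoBall_of_le_one hN a
  refine ⟨k, hk, fun ζ R hζ hζR => ?_⟩
  by_cases hζ0 : ζ = 0
  · subst hζ0
    have hR : 1 < R := by simpa using hζR
    -- For ζ = 0 the condition forces R > 1, so the ball is the whole closed unit ball and any
    -- nonzero centre may replace ζ.
    have hsub : ∀ ζ : CSpace N, pseudoBall ζ 1 ⊆ pseudoBall 0 R := fun ζ w hw => by
      refine ⟨hw.1, ?_⟩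
      have : ‖w‖ ≤ 1 := by simpa using hw.1
      simp only [pseudoDist, true_or, if_true, norm_zero, zero_add]
      linarith
    set η : CSpace N := EuclideanSpace.single ⟨0, hN⟩ (1 / 2 : ℂ) with hη
    have hηn : ‖η‖ = 1 / 2 := by simp [hη]
    rw [min_eq_right hR.le]
    refine (h η 1 ?_ ?_ ?_ le_rfl).trans (measure_mono (hsub η))
    · rw [← norm_ne_zero_iff, hηn]; norm_num
    · rw [mem_ball_zero_iff, hηn]; norm_num
    · rw [hηn]; norm_num
  · refine (h ζ (min R 1) hζ0 hζ (lt_min hζR ?_) (min_le_right _ _)).trans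
      (measure_mono (pseudoBall_mono ζ (min_le_left _ _)))
    linarith [norm_pos_iff.2 hζ0]

end LowerBound

/-! ### The rotation argument on small pseudo-balls, and the final suprema. -/

section Local

variable {N : ℕ} {a b c p q Q : ℝ} {ω : CSpace N → ℝ}

/-- Multiplication by a unimodular number, as a linear isometry of `ℂ^N`. -/
def rotation (N : ℕ) (l : ℂ) (hl : ‖l‖ = 1) : CSpace N ≃ₗᵢ[ℂ] CSpace N where
  toLinearEquiv := LinearEquiv.smulOfNeZero ℂ (CSpace N) l (by rintro rfl; simp at hl)
  norm_map' w := by simp [norm_smul, hl]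

lemma rotation_apply (l : ℂ) (hl : ‖l‖ = 1) (w : CSpace N) : rotation N l hl w = l • w := rfl

lemma weightedMu_anti (ω : CSpace N → ℝ) {r r' : ℝ} (h : r ≤ r') {s : Set (CSpace N)}
    (hs : MeasurableSet s) : weightedMu ω r' s ≤ weightedMu ω r s := by
  rw [weightedMu_apply _ _ hs, weightedMu_apply _ _ hs]
  refine lintegral_mono_ae ?_
  filter_upwards [ae_mem_unitBall] with z hz
  refine mul_le_mul_left (ENNReal.ofReal_le_ofReal ?_) _
  exact Real.rpow_le_rpow_of_exponent_ge (one_sub_norm_sq_pos hz) (by linarith [sq_nonneg ‖z‖]) h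

/-- The test power is (1 - |w|²)^t. Taking t = (Q - q)/p gives q + pt = Q exactly; if Q ≤ q, t = 0
is also allowed since μ_q ≤ μ_Q. This is where the two values of c come from. -/
lemma weightedMu_mul_muW_rpow_le_weightedMu (hp : 1 < p) (hω : IsWeight ω)
    (hT : ∀ f : CSpace N → ℂ, MemLp f (ENNReal.ofReal p) (weightedMu ω q) →
      ∀ᵐ z ∂(mu N), Integrable (integrandT a b q f z) (muW N q))
    {C : NNReal} (hC : ∀ f : CSpace N → ℂ, MemLp f (ENNReal.ofReal p) (weightedMu ω q) →
      eLpNorm (opT a b q f) (ENNReal.ofReal p) (weightedMu ω Q)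
        ≤ C * eLpNorm f (ENNReal.ofReal p) (weightedMu ω q))
    (hc : (Q ≤ q ∧ c = b) ∨ c = b + (Q - q) / p)
    {E F : Set (CSpace N)} (hE : MeasurableSet E) (hF : MeasurableSet F)
    {u : ℂ} (hu : ‖u‖ = 1) {m : ℝ} (hm : 0 ≤ m)
    (hk : ∀ z ∈ F ∩ unitBall N, ∀ w ∈ E ∩ unitBall N, m ≤ (u * kernel a z w).re) :
    weightedMu ω Q F * (ENNReal.ofReal m * muW N c E) ^ p ≤
      (C : ℝ≥0∞) ^ p * weightedMu ω Q E := by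
  have hfin : weightedMu ω Q E ≠ ∞ :=
    ((measure_mono (Set.subset_univ E)).trans_lt (weightedMu_univ_lt_top hp hω hT hC)).ne
  rcases hc with ⟨hQ, rfl⟩ | rfl
  · have hle : weightedMu ω (q + p * 0) E ≤ weightedMu ω Q E :=
      weightedMu_anti ω (by linarith) hE
    have h := weightedMu_mul_muW_rpow_le hp hω.aemeasurable hT hC hE hF hu hm hk 0
      (ne_top_of_le_ne_top hfin hle)
    rw [add_zero] at h
    exact h.trans (by gcongr)
  · have e : q + p * ((Q - q) / p) = Q := by
      have : p ≠ 0 := by linarith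
      field_simp; ring
    have h := weightedMu_mul_muW_rpow_le hp hω.aemeasurable hT hC hE hF hu hm hk ((Q - q) / p)
      (by rwa [e])
    rwa [e] at h

lemma bbProduct_eq (hp : 1 < p) (ζ : CSpace N) (R : ℝ) (κ : ℝ≥0∞) :
    bbProduct b p q Q ω ζ R κ = κ ^ p * (weightedMu ω Q (pseudoBall ζ R) *
      dualMu b p q ω (pseudoBall ζ R) ^ (p - 1)) := by
  have hp1 : 0 ≤ p - 1 := by linarith
  have hB := measurableSet_pseudoBall ζ R
  have hκ : κ ^ p = κ * κ ^ (p - 1) := by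
    conv_lhs => rw [show p = 1 + (p - 1) by ring]
    rw [ENNReal.rpow_add_of_nonneg _ _ zero_le_one hp1, ENNReal.rpow_one]
  rw [bbProduct, weightedMu, dualMu, withDensity_apply _ hB, withDensity_apply _ hB,
    ENNReal.mul_rpow_of_nonneg _ _ hp1, hκ]
  ring

/-- The two test inequalities on a pseudo-ball and on its image under a rotation that moves it by a
large multiple of its radius, combined. -/
lemma exists_weightedMu_mul_dualMu_pseudoBall_le (hN : 1 ≤ N) (hp : 1 < p) (hω : IsWeight ω)
    (hT : ∀ f : CSpace N → ℂ, MemLp f (ENNReal.ofReal p) (weightedMu ω q) →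
      ∀ᵐ z ∂(mu N), Integrable (integrandT a b q f z) (muW N q))
    {C : NNReal} (hC : ∀ f : CSpace N → ℂ, MemLp f (ENNReal.ofReal p) (weightedMu ω q) →
      eLpNorm (opT a b q f) (ENNReal.ofReal p) (weightedMu ω Q)
        ≤ C * eLpNorm f (ENNReal.ofReal p) (weightedMu ω q)) (hC0 : C ≠ 0)
    (hc : (Q ≤ q ∧ c = b) ∨ c = b + (Q - q) / p) :
    ∃ ε k : ℝ, 0 < ε ∧ ε < 1 ∧ 0 < k ∧ ∀ (ζ : CSpace N) (R : ℝ), ζ ∈ unitBall N →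
      1 - ‖ζ‖ < R → R ≤ ε →
      (ENNReal.ofReal (k * R ^ (-((N : ℝ) + 1 + a))) ^ 2 * muW N c (pseudoBall ζ R)) ^ p *
        (weightedMu ω Q (pseudoBall ζ R) * dualMu b p q ω (pseudoBall ζ R) ^ (p - 1)) ≤
        (C : ℝ≥0∞) ^ p * (C : ℝ≥0∞) ^ p := by
  have hp0 : 0 < p := by linarith
  set s : ℝ := (N : ℝ) + 1 + a with hs
  have hpos := ae_weight_pos hN hp hω hT hC
  obtain ⟨ε, hε, hε1, hker⟩ := exists_half_le_re_one_div_cpow s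
  refine ⟨ε / 8, (8 / ε) ^ (-s) / 2, by positivity, by linarith, by positivity,
    fun ζ R hζ hζR hRε => ?_⟩
  have hζ1 : ‖ζ‖ < 1 := by simpa using hζ
  have hR : 0 < R := by linarith
  -- Chosen so that the bound 8R on B × B equals ε t, the admissible deviation from 1 - l; R ≤ ε/8
  -- makes t ≤ 1.
  set t : ℝ := 8 / ε * R with ht
  have ht0 : 0 < t := by positivity
  have ht1 : t ≤ 1 := by
    rw [ht, div_mul_eq_mul_div, div_le_one hε]; linarith
  have hεt : ε * t = 8 * R := by rw [ht]; field_simp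
  obtain ⟨l, hl, hlt, hlre⟩ := exists_norm_eq_one_norm_one_sub_eq ht0.le ht1
  have hlc : ‖(starRingEnd ℂ) l‖ = 1 := by rw [Complex.norm_conj, hl]
  have hll : l * (starRingEnd ℂ) l = 1 := by
    rw [Complex.mul_conj, Complex.normSq_eq_norm_sq, hl]; simp
  have hlct : ‖1 - (starRingEnd ℂ) l‖ = t := by
    rw [← hlt, ← Complex.norm_conj (1 - l)]; simp
  obtain ⟨u₁, hu₁, hk₁⟩ := hker (1 - l) (by rw [hlre]; positivity)
  obtain ⟨u₂, hu₂, hk₂⟩ := hker (1 - (starRingEnd ℂ) l) (by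
    have : (1 - (starRingEnd ℂ) l).re = (1 - l).re := by simp
    rw [this, hlre]; positivity)
  rw [hlt] at hk₁
  rw [hlct] at hk₂
  set m : ℝ := t ^ (-s) / 2 with hm
  have hm0 : 0 ≤ m := by positivity
  have hmk : m = (8 / ε) ^ (-s) / 2 * R ^ (-s) := by
    rw [hm, ht, Real.mul_rpow (by positivity) hR.le]; ring
  rw [← hmk]
  set B := pseudoBall ζ R with hBdef
  have hB : MeasurableSet B := measurableSet_pseudoBall ζ R
  -- The preimage of B under multiplication by the conjugate of l is lB.
  set U := rotation N ((starRingEnd ℂ) l) hlc with hU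
  have hB' : MeasurableSet (U ⁻¹' B) := U.continuous.measurable hB
  have hBB : ∀ z ∈ B, ∀ w ∈ B, ‖1 - herm z w‖ ≤ ε * t := fun z hz w hw => by
    rw [hεt]
    exact norm_one_sub_herm_le_of_pseudoBall (by linarith) hζ hζR hz hw
  have hUl : ∀ z, z = l • U z := fun z => by
    rw [hU, rotation_apply, smul_smul, hll, one_smul]
  have hK₁ : ∀ z ∈ U ⁻¹' B ∩ unitBall N, ∀ w ∈ B ∩ unitBall N,
      m ≤ (u₁ * kernel a z w).re := by
    rintro z ⟨hz, -⟩ w ⟨hw, -⟩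
    refine hk₁ (1 - herm z w) ?_
    have e : 1 - herm z w - (1 - l) = l * (1 - herm (U z) w) := by
      conv_lhs => rw [hUl z, herm_smul_left]
      ring
    rw [e, norm_mul, hl, one_mul]
    exact hBB _ hz _ hw
  have hK₂ : ∀ z ∈ B ∩ unitBall N, ∀ w ∈ U ⁻¹' B ∩ unitBall N,
      m ≤ (u₂ * kernel a z w).re := by
    rintro z ⟨hz, -⟩ w ⟨hw, -⟩
    refine hk₂ (1 - herm z w) ?_
    have e : 1 - herm z w - (1 - (starRingEnd ℂ) l) =
        (starRingEnd ℂ) l * (1 - herm z (U w)) := by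
      conv_lhs => rw [hUl w, herm_smul_right]
      ring
    rw [e, norm_mul, hlc, one_mul]
    exact hBB _ hz _ hw
  have ineq₁ := weightedMu_mul_dualMu_rpow_le hp hω.aemeasurable hpos hT hC hC0 hB hB' hu₁ hm0 hK₁
  have ineq₂ := weightedMu_mul_muW_rpow_le_weightedMu hp hω hT hC hc hB' hB hu₂ hm0 hK₂
  rw [muW_preimage U c hB] at ineq₂
  have e2 : (ENNReal.ofReal m ^ 2 * muW N c B) ^ p =
      ENNReal.ofReal m ^ p * (ENNReal.ofReal m * muW N c B) ^ p := by
    rw [← ENNReal.mul_rpow_of_nonneg _ _ hp0.le]; congr 1; ring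
  -- `ineq₂` trades the ω-mass of B for that of lB, which `ineq₁` then absorbs; no division is
  -- needed.
  calc (ENNReal.ofReal m ^ 2 * muW N c B) ^ p *
        (weightedMu ω Q B * dualMu b p q ω B ^ (p - 1))
      = (weightedMu ω Q B * (ENNReal.ofReal m * muW N c B) ^ p) *
          (ENNReal.ofReal m ^ p * dualMu b p q ω B ^ (p - 1)) := by rw [e2]; ring
    _ ≤ ((C : ℝ≥0∞) ^ p * weightedMu ω Q (U ⁻¹' B)) *
          (ENNReal.ofReal m ^ p * dualMu b p q ω B ^ (p - 1)) := by gcongr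
    _ = (C : ℝ≥0∞) ^ p *
          (weightedMu ω Q (U ⁻¹' B) * ENNReal.ofReal m ^ p * dualMu b p q ω B ^ (p - 1)) := by ring
    _ ≤ (C : ℝ≥0∞) ^ p * (C : ℝ≥0∞) ^ p := by gcongr

lemma ofReal_rpow_neg_sq {x : ℝ} (hx : 0 < x) (s : ℝ) :
    ENNReal.ofReal (x ^ (-s)) ^ 2 = (ENNReal.ofReal (x ^ (2 * s)))⁻¹ := by
  rw [← ENNReal.ofReal_inv_of_pos (by positivity), ← ENNReal.ofReal_pow (by positivity),
    ← Real.rpow_natCast, ← Real.rpow_mul hx.le, ← Real.rpow_neg hx.le]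
  congr 2; push_cast; ring

lemma exists_bbProduct_le (hN : 1 ≤ N) (ha : -((N : ℝ) + 1) < a) (hp : 1 < p)
    (hω : IsWeight ω) (hT : IsBoundedT a b p q Q ω)
    (hc1 : -1 < c) (hc : (Q ≤ q ∧ c = b) ∨ c = b + (Q - q) / p) :
    ∃ M : ℝ≥0∞, M < ∞ ∧ ∀ (ζ : CSpace N) (R : ℝ), ζ ∈ unitBall N → 1 - ‖ζ‖ < R →
      bbProduct b p q Q ω ζ R (muW N c (pseudoBall ζ R) /
        ENNReal.ofReal (min R 1 ^ (2 * ((N : ℝ) + 1 + a)))) ≤ M := by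
  have hp0 : 0 < p := by linarith
  have hp1 : 0 ≤ p - 1 := by linarith
  obtain ⟨hT, C₀, hC₀⟩ := hT
  -- Enlarging the constant makes it nonzero, as the exhaustion argument needs.
  set C : NNReal := C₀ + 1 with hCdef
  have hC0 : C ≠ 0 := by positivity
  have hC : ∀ f : CSpace N → ℂ, MemLp f (ENNReal.ofReal p) (weightedMu ω q) →
      eLpNorm (opT a b q f) (ENNReal.ofReal p) (weightedMu ω Q)
        ≤ C * eLpNorm f (ENNReal.ofReal p) (weightedMu ω q) := fun f hf =>
    (hC₀ f hf).trans (by gcongr; rw [hCdef]; exact le_self_add)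
  set s : ℝ := (N : ℝ) + 1 + a with hs
  have hs0 : 0 < s := by linarith
  obtain ⟨ε, k, hε, hε1, hk, hsmall⟩ :=
    exists_weightedMu_mul_dualMu_pseudoBall_le hN hp hω hT hC hC0 hc
  have hX := weightedMu_univ_lt_top hp hω hT hC
  have hY := dualMu_univ_lt_top hN hp hω hT hC hC0
  have hCp : (C : ℝ≥0∞) ^ p ≠ ∞ := ENNReal.rpow_ne_top_of_nonneg hp0.le ENNReal.coe_ne_top
  have hkk0 : (ENNReal.ofReal k ^ 2) ^ p ≠ 0 := by
    simp [ENNReal.rpow_eq_zero_iff, hk, hp0.not_gt]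
  have hkkt : (ENNReal.ofReal k ^ 2) ^ p ≠ ∞ :=
    ENNReal.rpow_ne_top_of_nonneg hp0.le (ENNReal.pow_ne_top ENNReal.ofReal_ne_top)
  set M₁ : ℝ≥0∞ := (C : ℝ≥0∞) ^ p * (C : ℝ≥0∞) ^ p / (ENNReal.ofReal k ^ 2) ^ p with hM₁
  set M₂ : ℝ≥0∞ := (muW N c Set.univ / ENNReal.ofReal (ε ^ (2 * s))) ^ p *
    (weightedMu ω Q Set.univ * dualMu b p q ω Set.univ ^ (p - 1)) with hM₂
  refine ⟨max M₁ M₂, max_lt ?_ ?_, fun ζ R hζ hζR => ?_⟩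
  · exact ENNReal.div_lt_top (ENNReal.mul_ne_top hCp hCp) hkk0
  · refine ENNReal.mul_lt_top (ENNReal.rpow_lt_top_of_nonneg hp0.le ?_)
      (ENNReal.mul_lt_top hX (ENNReal.rpow_lt_top_of_nonneg hp1 hY.ne))
    exact (ENNReal.div_lt_top (muW_univ_lt_top hN hc1).ne
      (ENNReal.ofReal_pos.2 (by positivity)).ne').ne
  have hζ1 : ‖ζ‖ < 1 := by simpa using hζ
  have hR : 0 < R := by linarith
  rw [bbProduct_eq hp]
  rcases le_or_gt R ε with hRε | hRε
  · refine le_trans ?_ (le_max_left _ _)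
    rw [hM₁, ENNReal.le_div_iff_mul_le (Or.inl hkk0) (Or.inl hkkt), min_eq_left (by linarith)]
    refine le_trans (le_of_eq ?_) (hsmall ζ R hζ hζR hRε)
    rw [mul_right_comm, ← ENNReal.mul_rpow_of_nonneg _ _ hp0.le, ENNReal.ofReal_mul hk.le,
      mul_pow, ofReal_rpow_neg_sq hR, div_eq_mul_inv]
    congr 2
    ring
  · refine le_trans ?_ (le_max_right _ _)
    rw [hM₂]
    gcongr
    · exact Set.subset_univ _
    · exact le_min hRε.le hε1.le
    · exact Set.subset_univ _
    · exact Set.subset_univ _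

/-- The product is homogeneous of degree p in its factor, so a factor dominated by A times the
reference one costs only A^p. -/
theorem iSup_bbProduct_lt_top (κ : CSpace N → ℝ → ℝ≥0∞) (hN : 1 ≤ N)
    (ha : -((N : ℝ) + 1) < a) (hp : 1 < p)
    (hω : IsWeight ω) (hT : IsBoundedT a b p q Q ω)
    (hc1 : -1 < c) (hc : (Q ≤ q ∧ c = b) ∨ c = b + (Q - q) / p) {A : ℝ≥0∞} (hA : A ≠ ∞)
    (hκ : ∀ ζ ∈ unitBall N, ∀ R, 1 - ‖ζ‖ < R → κ ζ R ≤ A * (muW N c (pseudoBall ζ R) /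
        ENNReal.ofReal (min R 1 ^ (2 * ((N : ℝ) + 1 + a))))) :
    ⨆ (ζ : CSpace N) (R : ℝ) (_ : ζ ∈ unitBall N) (_ : TouchesBoundary ζ R),
      bbProduct b p q Q ω ζ R (κ ζ R) < ∞ := by
  have hp0 : 0 < p := by linarith
  obtain ⟨M, hM, h⟩ := exists_bbProduct_le hN ha hp hω hT hc1 hc
  refine lt_of_le_of_lt (b := A ^ p * M) ?_
    (ENNReal.mul_lt_top (ENNReal.rpow_lt_top_of_nonneg hp0.le hA) hM)
  refine iSup_le fun ζ => iSup_le fun R => iSup_le fun hζ => iSup_le fun hR => ?_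
  have hζR := hR.one_sub_norm_lt
  refine le_trans ?_ (mul_le_mul_right (h ζ R hζ hζR) _)
  rw [bbProduct_eq hp, bbProduct_eq hp, ← mul_assoc (A ^ p), ← ENNReal.mul_rpow_of_nonneg _ _ hp0.le]
  gcongr
  exact hκ ζ hζ R hζR

theorem bbSupRadius_lt_top (hN : 1 ≤ N) (ha : -((N : ℝ) + 1) < a) (hp : 1 < p)
    (hω : IsWeight ω) (hT : IsBoundedT a b p q Q ω)
    (hc1 : -1 < c) (hc : (Q ≤ q ∧ c = b) ∨ c = b + (Q - q) / p) :
    bbSupRadius a b c p q Q ω < ∞ := by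
  refine iSup_bbProduct_lt_top (fun ζ R => muW N c (pseudoBall ζ R) /
    ENNReal.ofReal (R ^ (2 * ((N : ℝ) + 1 + a)))) hN ha hp hω hT hc1 hc ENNReal.one_ne_top ?_
  intro ζ hζ R hζR
  have hζ1 : ‖ζ‖ < 1 := by simpa using hζ
  have hR : 0 < min R 1 := lt_min (by linarith) one_pos
  rw [one_mul]
  gcongr
  · linarith
  · exact min_le_left _ _

theorem bbSupMeasure_lt_top (hN : 1 ≤ N) (ha : -((N : ℝ) + 1) < a) (hp : 1 < p)
    (hω : IsWeight ω) (hT : IsBoundedT a b p q Q ω)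
    (hc1 : -1 < c) (hc : (Q ≤ q ∧ c = b) ∨ c = b + (Q - q) / p) :
    bbSupMeasure a b c p q Q ω < ∞ := by
  obtain ⟨k, hk, hlow⟩ := exists_le_muW_pseudoBall hN a
  have hk0 : ENNReal.ofReal k ^ 2 ≠ 0 := by simp [hk]
  refine iSup_bbProduct_lt_top (fun ζ R => muW N c (pseudoBall ζ R) /
    muW N a (pseudoBall ζ R) ^ 2) hN ha hp hω hT hc1 hc
    (ENNReal.inv_ne_top.2 hk0) ?_
  intro ζ hζ R hζR
  have hζ1 : ‖ζ‖ < 1 := by simpa using hζ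
  have hR : 0 < min R 1 := lt_min (by linarith) one_pos
  have h1 : ENNReal.ofReal k ^ 2 * ENNReal.ofReal (min R 1 ^ (2 * ((N : ℝ) + 1 + a))) ≤
      muW N a (pseudoBall ζ R) ^ 2 := by
    refine le_trans (le_of_eq ?_) (pow_le_pow_left₀ (zero_le) (hlow ζ R hζ hζR) 2)
    rw [ENNReal.ofReal_mul hk.le, mul_pow, ← ENNReal.ofReal_pow (by positivity),
      ← ENNReal.ofReal_pow (by positivity)]
    congr 2
    rw [← Real.rpow_natCast, ← Real.rpow_mul hR.le]
    congr 1; push_cast; ring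
  calc muW N c (pseudoBall ζ R) / muW N a (pseudoBall ζ R) ^ 2
      ≤ muW N c (pseudoBall ζ R) / (ENNReal.ofReal k ^ 2 *
        ENNReal.ofReal (min R 1 ^ (2 * ((N : ℝ) + 1 + a)))) := by gcongr
    _ = _ := by
      rw [div_eq_mul_inv, div_eq_mul_inv, ENNReal.mul_inv (Or.inl hk0)
        (Or.inl (ENNReal.pow_ne_top ENNReal.ofReal_ne_top))]
      ring

end Local

end BergmanBesov

end

theorem mainTheorem5 (N : ℕ) (hN : 1 ≤ N) (a b p q Q : ℝ)
    (ha : -((N : ℝ) + 1) < a) (hb : -1 < b) (hp : 1 < p)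
    (ω : BergmanBesov.CSpace N → ℝ) (hω : BergmanBesov.IsWeight ω)
    (hT : BergmanBesov.IsBoundedT a b p q Q ω) :
    BergmanBesov.MemBp a b p q Q ω := by
  refine ⟨fun hQ => ?_, fun hQ => ?_⟩
  · have hc : (Q ≤ q ∧ b = b) ∨ b = b + (Q - q) / p := Or.inl ⟨hQ, rfl⟩
    exact ⟨fun _ => BergmanBesov.bbSupMeasure_lt_top hN ha hp hω hT hb hc,
      BergmanBesov.bbSupRadius_lt_top hN ha hp hω hT hb hc⟩
  · have hc1 : -1 < b + (Q - q) / p := by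
      have : 0 < (Q - q) / p := div_pos (by linarith) (by linarith)
      linarith
    exact ⟨fun _ => BergmanBesov.bbSupMeasure_lt_top hN ha hp hω hT hc1 (Or.inr rfl),
      BergmanBesov.bbSupRadius_lt_top hN ha hp hω hT hc1 (Or.inr rfl)⟩
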